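/- For a nondecreasing finite sequence $\lambda_1\le\dots\le\lambda_s$ of real numbers, the Gelfand–Tsetlin polytope $GZ(\lambda_1\dots\lambda_s)\subset\mathbb R^{s(s-1)/2}$ is the set of all $(u_{a,b})_{1\le a\le s-1,\ 1\le b\le s-a}$ such that $u_{a-1,b}\le u_{a,b}\le u_{a-1,b+1}$ for all such $a,b$, where $u_{0,b}:=\lambda_b$ (for $s\le 1$ it is a single point). Sequences with repetitions are written multiplicatively. For a polytope $P$ of dimension $n$ let $f_P(t)=f_0+f_1t+\dots+f_nt^n$, where $f_d$ is the number of nonempty $d$-dimensional faces of $P$ (including $P$ itself). Two polytopes are combinatorially equivalent if their face lattices are isomorphic. Let $k\ge 1$ and let $i=(i_1,\dots,i_k)$ be positive integers. Let $C\subset\mathbb R^{k-1}$ be the cube $$1\le u_1\le 2\le u_2\le 3\le\dots\le k-1\le u_{k-1}\le k,$$ and let $\pi$ be the linear map $u\mapsto (u_{1,i_1},\,u_{1,i_1+i_2},\dots,u_{1,i_1+\dots+i_{k-1}})$. The barycenter $\widehat A$ of a nonempty face $A$ of $C$ has coordinates $\widehat A_j\in\{j,\,j+\tfrac12,\,j+1\}$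 for $1\le j\le k-1$; to $A$ we associate the monomial $\prod_{j=1}^{k-1}x_{\widehat A_j}$ of the polynomial $$p=\prod_{j=1}^{k-1}(x_j+x_{j+0.5}+x_{j+1})=\sum_\alpha c_\alpha\,x_1^{\alpha_1}x_{1.5}^{\alpha_{1.5}}\cdots x_{k-0.5}^{\alpha_{k-0.5}}x_k^{\alpha_k},\qquad \alpha=(\alpha_1,\alpha_{1.5},\dots,\alpha_{k-0.5},\alpha_k).$$ This is a bijection between the nonempty faces of $C$ and the monomials occurring in $p$; let $A_\alpha$ be the face corresponding to the monomial with exponent $\alpha$. Put $$GZ[\alpha,i]=GZ\bigl(1^{i_1-1+\alpha_1}\,1.5^{\alpha_{1.5}}\,2^{i_2-1+\alpha_2}\cdots(k-0.5)^{\alpha_{k-0.5}}\,k^{i_k-1+\alpha_k}\bigr).$$ Then $\pi$ maps $GZ(1^{i_1}2^{i_2}\dots k^{i_k})$ onto $C$; for every nonempty face $A=A_\alpha$ of $C$ the fibre $GZ(1^{i_1}\dots k^{i_k})\cap\pi^{-1}(\widehat A_\alpha)$ is combinatorially equivalent to $GZ[\alpha,i]$; and $$f_{GZ(1^{i_1}\dots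 k^{i_k})}(t)=\sum_{\alpha} c_\alpha\, t^{\dim A_\alpha}\, f_{GZ[\alpha,i]}(t),$$ where the sum is over all $\alpha$ with $c_\alpha\ne 0$. -/

import Mathlib

namespace GZ

/-! ### Faces, dimension, combinatorial equivalence, `f`-polynomial -/

section Faces

variable {E : Type*} [AddCommGroup E] [Module ℝ E] [TopologicalSpace E]
variable {E' : Type*} [AddCommGroup E'] [Module ℝ E'] [TopologicalSpace E']

/-- The dimension of a subset of a real vector space: the dimension of its affine hull. -/
noncomputable def dim (F : Set E) : ℕ := Module.finrank ℝ (vectorSpan ℝ F)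

/-- The face lattice `L(P)` of a polytope `P`, ordered by inclusion. The faces are `∅`, `P` and the
intersections of `P` with its supporting hyperplanes. -/
abbrev Face (P : Set E) : Type _ := {F : Set E // IsExposed ℝ P F}

/-- Combinatorial equivalence of polytopes: their face lattices are isomorphic. -/
def CombEquiv (P : Set E) (P' : Set E') : Prop := Nonempty (Face P ≃o Face P')

/-- The number `f_d` of (nonempty) `d`-dimensional faces. -/
noncomputable def faceCount (P : Set E) (d : ℕ) : ℕ :=
  Set.ncard {F : Set E | IsExposed ℝ P F ∧ F.Nonempty ∧ dim F = d}

/-- The `f`-polynomial `f_0 + f_1 t + … + f_n t ^ n`, where `n = dim P`. -/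
noncomputable def fPoly (P : Set E) : Polynomial ℕ :=
  ∑ d ∈ Finset.range (dim P + 1), Polynomial.C (faceCount P d) * Polynomial.X ^ d

end Faces

/-! ### Gelfand–Tsetlin polytopes -/

/-- Positions `(a, b)` of the unknowns `u_{a,b}` of the triangular table with top row of length
`s`: here `1 ≤ a ≤ s - 1` and `1 ≤ b ≤ s - a`. -/
abbrev Idx (s : ℕ) : Type := {p : ℕ × ℕ // 1 ≤ p.1 ∧ 1 ≤ p.2 ∧ p.1 + p.2 ≤ s}

instance (s : ℕ) : Finite (Idx s) :=
  Set.Finite.to_subtype <| ((Set.finite_Iic s).prod (Set.finite_Iic s)).subset fun p hp => by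
    obtain ⟨h1, h2, h3⟩ := hp
    exact ⟨show p.1 ≤ s by omega, show p.2 ≤ s by omega⟩

/-- The entry in position `(a, b)` of the triangular table: row `0` is the given sequence
`l = (λ_1, …, λ_s)`, the lower rows are the unknowns `u_{a,b}` (and `0` outside the table). -/
noncomputable def entry (l : List ℝ) (u : Idx l.length → ℝ) (a b : ℕ) : ℝ :=
  if a = 0 then l.getD (b - 1) 0
  else if h : 1 ≤ a ∧ 1 ≤ b ∧ a + b ≤ l.length then u ⟨(a, b), h⟩ else 0

/-- The Gelfand–Tsetlin polytope of the nondecreasing sequence `l`: every unknown lies between its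
two upper neighbours in the triangular table. -/
def polytope (l : List ℝ) : Set (Idx l.length → ℝ) :=
  {u | ∀ p : Idx l.length,
    entry l u (p.1.1 - 1) p.1.2 ≤ u p ∧ u p ≤ entry l u (p.1.1 - 1) (p.1.2 + 1)}

/-- The sequence `1^{i_1} 2^{i_2} … k^{i_k}`. -/
noncomputable def seq (k : ℕ) (i : ℕ → ℕ) : List ℝ :=
  (List.range' 1 k).flatMap fun q => List.replicate (i q) (q : ℝ)

/-- The sequence `1^{i_1-1+α_1} 1.5^{α_{1.5}} 2^{i_2-1+α_2} … (k-0.5)^{α_{k-0.5}} k^{i_k-1+α_k}`.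
The half-integer index `r = n / 2` is encoded by the natural number `n`, so `α n` is the exponent
`α_{n/2}`, and `n` runs from `2` to `2 * k`. -/
noncomputable def reducedSeq (k : ℕ) (i : ℕ → ℕ) (α : ℕ →₀ ℕ) : List ℝ :=
  (List.range' 2 (2 * k - 1)).flatMap fun n =>
    List.replicate (if Even n then i (n / 2) - 1 + α n else α n) ((n : ℝ) / 2)

/-! ### The cube and the projection onto it -/

/-- The cube `1 ≤ u_1 ≤ 2 ≤ u_2 ≤ 3 ≤ … ≤ k - 1 ≤ u_{k-1} ≤ k`. -/
def cube (k : ℕ) : Set (Finset.Ico 1 k → ℝ) :=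
  {u | ∀ j : Finset.Ico 1 k, (j : ℝ) ≤ u j ∧ u j ≤ (j : ℝ) + 1}

/-- The linear projection `u ↦ (u_{1,i_1}, u_{1,i_1+i_2}, …, u_{1,i_1+…+i_{k-1}})`, which remembers
the second-row entries standing between different numbers of the first row.
(When all `i_q ≥ 1` the listed positions are in the table and the `else` branch is not used.) -/
noncomputable def proj (k : ℕ) (i : ℕ → ℕ) :
    (Idx (seq k i).length → ℝ) →ₗ[ℝ] (Finset.Ico 1 k → ℝ) :=
  LinearMap.pi fun j : Finset.Ico 1 k =>
    if h : 1 ≤ 1 ∧ 1 ≤ (∑ q ∈ Finset.Icc 1 (j : ℕ), i q) ∧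
        1 + (∑ q ∈ Finset.Icc 1 (j : ℕ), i q) ≤ (seq k i).length
    then LinearMap.proj ⟨(1, ∑ q ∈ Finset.Icc 1 (j : ℕ), i q), h⟩ else 0

/-- The nonempty face of the cube described by `e`: the coordinate `u_j` is fixed to `j` if
`e j = 0`, is free in `[j, j + 1]` if `e j = 1`, and is fixed to `j + 1` if `e j = 2`. -/
def cubeFace {k : ℕ} (e : Finset.Ico 1 k → Fin 3) : Set (Finset.Ico 1 k → ℝ) :=
  {u | u ∈ cube k ∧
    ∀ j : Finset.Ico 1 k, (e j = 0 → u j = (j : ℝ)) ∧ (e j = 2 → u j = (j : ℝ) + 1)}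

/-- The barycenter of `cubeFace e`: its coordinates are `u_j = j`, `j + 0.5` or `j + 1`. -/
noncomputable def barycenter {k : ℕ} (e : Finset.Ico 1 k → Fin 3) : Finset.Ico 1 k → ℝ :=
  fun j => (j : ℝ) + ((e j : ℕ) : ℝ) / 2

/-- The polynomial `p = ∏_{j=1}^{k-1} (x_j + x_{j+0.5} + x_{j+1})`, where the variable `x_{n/2}` is
`X n`. -/
noncomputable def monomialPoly (k : ℕ) : MvPolynomial ℕ ℕ :=
  ∏ j ∈ Finset.Ico 1 k,
    (MvPolynomial.X (2 * j) + MvPolynomial.X (2 * j + 1) + MvPolynomial.X (2 * j + 2))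

/-- The exponent of the monomial `∏_j x_{u_j}` of `p`, where `(u_j)` is the barycenter of
`cubeFace e`. -/
noncomputable def exponent {k : ℕ} (e : Finset.Ico 1 k → Fin 3) : ℕ →₀ ℕ :=
  ∑ j : Finset.Ico 1 k, Finsupp.single (2 * (j : ℕ) + (e j : ℕ)) 1

/-- The face `A_α` of the cube whose barycenter corresponds to the monomial `x^α` of `p`. There is
at most one such face (`exponent_injective`), so that `A_α = cubeFace e` for `α = exponent e`
(`faceOfExponent_exponent`). -/
def faceOfExponent (k : ℕ) (α : ℕ →₀ ℕ) : Set (Finset.Ico 1 k → ℝ) :=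
  ⋃ (e : Finset.Ico 1 k → Fin 3) (_ : exponent e = α), cubeFace e

/-! ### The encoding of the faces of the cube is the intended one -/

theorem exponent_injective (k : ℕ) :
    Function.Injective (exponent : (Finset.Ico 1 k → Fin 3) → (ℕ →₀ ℕ)) := by
  intro e e' h
  have key : ∀ n (hn : n ∈ Finset.Ico 1 k), e ⟨n, hn⟩ = e' ⟨n, hn⟩ := by
    intro n
    induction n using Nat.strong_induction_on with
    | _ n ih =>
      intro hn
      have count : ∀ (f : Finset.Ico 1 k → Fin 3) (m : ℕ), exponent f m =
          ∑ j : Finset.Ico 1 k, if 2 * (j : ℕ) + (f j : ℕ) = m then 1 else 0 := by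
        intro f m
        simp [exponent, Finsupp.finsetSum_apply, Finsupp.single_apply]
      have split : ∀ (f g : Finset.Ico 1 k → Fin 3) (m : ℕ), m < 2 * n + 2 →
          exponent f m = exponent g m →
          (∀ l (hl : l ∈ Finset.Ico 1 k), l < n → f ⟨l, hl⟩ = g ⟨l, hl⟩) →
          ((2 * n + (f ⟨n, hn⟩ : ℕ) = m) ↔ (2 * n + (g ⟨n, hn⟩ : ℕ) = m)) := by
        intro f g m hm hfg hlt
        rw [count, count, ← Finset.add_sum_erase _ _ (Finset.mem_univ (⟨n, hn⟩ : Finset.Ico 1 k)),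
          ← Finset.add_sum_erase (Finset.univ) (fun j : Finset.Ico 1 k =>
            if 2 * (j : ℕ) + (g j : ℕ) = m then 1 else 0)
            (Finset.mem_univ (⟨n, hn⟩ : Finset.Ico 1 k))] at hfg
        have hrest : (∑ j ∈ Finset.univ.erase (⟨n, hn⟩ : Finset.Ico 1 k),
            if 2 * (j : ℕ) + (f j : ℕ) = m then 1 else 0) =
            ∑ j ∈ Finset.univ.erase (⟨n, hn⟩ : Finset.Ico 1 k),
            if 2 * (j : ℕ) + (g j : ℕ) = m then 1 else 0 := by
          refine Finset.sum_congr rfl ?_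
          rintro ⟨j, hj⟩ hjn
          have hne : j ≠ n := by
            rintro rfl
            simp at hjn
          rcases lt_or_gt_of_ne hne with h1 | h1
          · rw [hlt j hj h1]
          · rw [if_neg (by dsimp only; omega), if_neg (by dsimp only; omega)]
        rw [hrest] at hfg
        have := Nat.add_right_cancel hfg
        dsimp only at this
        split_ifs at this with h1 h2 h2 <;> simp_all
      have h0 := split e e' (2 * n) (by omega) (by rw [h]) (fun l hl hln => ih l hln hl)
      have h1 := split e e' (2 * n + 1) (by omega) (by rw [h]) (fun l hl hln => ih l hln hl)
      apply Fin.ext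
      have := (e ⟨n, hn⟩).isLt
      have := (e' ⟨n, hn⟩).isLt
      omega
  funext j
  exact key j.1 j.2

theorem faceOfExponent_exponent {k : ℕ} (e : Finset.Ico 1 k → Fin 3) :
    faceOfExponent k (exponent e) = cubeFace e := by
  ext u
  simp [faceOfExponent, (exponent_injective k).eq_iff]

theorem barycenter_mem_cubeFace {k : ℕ} (e : Finset.Ico 1 k → Fin 3) :
    barycenter e ∈ cubeFace e := by
  have h : ∀ x : Fin 3, ((x : ℕ) : ℝ) ≤ 2 := by
    intro x
    exact_mod_cast Nat.le_of_lt_succ x.isLt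
  refine ⟨fun j => ⟨?_, ?_⟩, fun j => ⟨fun hj => ?_, fun hj => ?_⟩⟩
  · simp only [barycenter]
    have : (0 : ℝ) ≤ ((e j : ℕ) : ℝ) := Nat.cast_nonneg _
    linarith
  · simp only [barycenter]
    linarith [h (e j)]
  · simp [barycenter, hj]
  · simp [barycenter, hj]

open Classical in
/-- The faces of the cube cut out by a linear functional. -/
theorem exposed_cube_eq {k : ℕ} (c : Finset.Ico 1 k → ℝ) :
    {u ∈ cube k | ∀ v ∈ cube k, ∑ j, c j * v j ≤ ∑ j, c j * u j} =
      cubeFace fun j => if c j < 0 then 0 else if c j = 0 then 1 else 2 := by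
  ext u
  constructor
  · rintro ⟨hu, hmax⟩
    refine ⟨hu, fun j => ?_⟩
    have step : ∀ x : ℝ, (j : ℝ) ≤ x → x ≤ (j : ℝ) + 1 → c j * x ≤ c j * u j := by
      intro x hx hx'
      have hv : Function.update u j x ∈ cube k := by
        intro l
        by_cases hl : l = j
        · subst hl
          simpa using ⟨hx, hx'⟩
        · simpa [Function.update_of_ne hl] using hu l
      have := hmax _ hv
      rw [← Finset.add_sum_erase _ _ (Finset.mem_univ j),
        ← Finset.add_sum_erase _ (fun l => c l * u l) (Finset.mem_univ j),
        Finset.sum_congr rfl (fun l hl => by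
          rw [Function.update_of_ne (Finset.ne_of_mem_erase hl)])] at this
      simp only [Function.update_self] at this
      exact le_of_add_le_add_right this
    have h1 := step (j : ℝ) le_rfl (by linarith)
    have h2 := step ((j : ℝ) + 1) (by linarith) le_rfl
    obtain ⟨h3, h4⟩ := hu j
    constructor
    · intro he
      dsimp only at he
      have hc : c j < 0 := by
        by_contra hc
        split_ifs at he <;> simp_all
      nlinarith
    · intro he
      dsimp only at he
      have hc : 0 < c j := by
        split_ifs at he with ha hb
        · simp at he
        · simp at he
        · exact lt_of_le_of_ne (not_lt.mp ha) (Ne.symm hb)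
      nlinarith
  · rintro ⟨hu, hf⟩
    refine ⟨hu, fun v hv => Finset.sum_le_sum fun j _ => ?_⟩
    obtain ⟨ha, hb⟩ := hf j
    obtain ⟨h1, h2⟩ := hv j
    rcases lt_trichotomy (c j) 0 with hc | hc | hc
    · rw [ha (by simp [hc])]
      nlinarith
    · simp [hc]
    · rw [hb (by simp [not_lt.mpr hc.le, hc.ne'])]
      nlinarith

/-- The nonempty faces of the cube are exactly the sets `cubeFace e`. -/
theorem isExposed_cube_iff {k : ℕ} (A : Set (Finset.Ico 1 k → ℝ)) :
    (IsExposed ℝ (cube k) A ∧ A.Nonempty) ↔ ∃ e : Finset.Ico 1 k → Fin 3, A = cubeFace e := by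
  classical
  constructor
  · rintro ⟨hA, hne⟩
    obtain ⟨l, rfl⟩ := hA hne
    have hl : ∀ v, l v = ∑ j, l (Pi.single j 1) * v j := by
      intro v
      have hv : v = ∑ j, v j • (Pi.single j (1 : ℝ) : Finset.Ico 1 k → ℝ) := by
        ext a
        simp [Pi.single_apply]
      conv_lhs => rw [hv]
      simp [mul_comm]
    rw [show {x ∈ cube k | ∀ y ∈ cube k, l y ≤ l x} = {u ∈ cube k | ∀ v ∈ cube k,
      ∑ j, l (Pi.single j 1) * v j ≤ ∑ j, l (Pi.single j 1) * u j} by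
        ext u
        constructor
        · rintro ⟨h1, h2⟩
          exact ⟨h1, fun v hv => by rw [← hl, ← hl]; exact h2 v hv⟩
        · rintro ⟨h1, h2⟩
          exact ⟨h1, fun v hv => by rw [hl, hl]; exact h2 v hv⟩]
    exact ⟨_, exposed_cube_eq _⟩
  · rintro ⟨e, rfl⟩
    refine ⟨fun _ => ?_, ⟨_, barycenter_mem_cubeFace e⟩⟩
    let c : Finset.Ico 1 k → ℝ := fun j => ((e j : ℕ) : ℝ) - 1
    refine ⟨∑ j, c j • ContinuousLinearMap.proj (R := ℝ) j, ?_⟩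
    have he : e = fun j => if c j < 0 then 0 else if c j = 0 then 1 else 2 := by
      funext j
      have hx : ∀ x : Fin 3, x = if ((x : ℕ) : ℝ) - 1 < 0 then 0
          else if ((x : ℕ) : ℝ) - 1 = 0 then 1 else 2 := by
        intro x
        fin_cases x <;> norm_num
        rfl
      exact hx (e j)
    conv_lhs => rw [he]
    rw [← exposed_cube_eq c]
    simp

end GZ

/-! A nonempty face of a polyhedron is determined by the set of inequalities that are tight at a
suitable point of it, and its dimension is that of the common kernel of the tight linear parts
(`fPoly_polyhedron`). For a Gelfand–Tsetlin polytope the f-polynomial therefore becomes a sum over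
`pattern`s, the sets of equalities between neighbouring entries of a table.

An entry of the first row of unknowns that lies under two equal numbers is forced, and the remaining
ones are the coordinates of the projection to the cube. Fixing a point of the cube thus fixes the
whole first row, and what remains is a table with that row as its top row (`fibre_eq`). Over the
barycenter of a face this row is the sorted sequence defining GZ[α,i] (`reducedSeq_exponent`).

To count faces, apply to all entries a strictly increasing function that fixes the integers and
moves each non-integral coordinate of the projection to the midpoint of its interval. This preserves
the pattern, so every pattern already occurs over a barycenter (`exists_pattern_eq`). The pattern
also shows which barycenter (`extendPattern_face_unique`), so the patterns split into disjoint
classes indexed by the faces of the cube. Each class is a copy of the patterns of the fibre, and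
passing to the whole polytope raises the dimension by the number of free coordinates
(`finrank_direction_extendPattern`). Finally, distinct faces of the cube give distinct monomials, so
every nonzero c_α is 1. -/

namespace GZ

/-! ### Faces of polyhedra and their active sets -/

section Polyhedron

variable {E : Type*} [AddCommGroup E] [Module ℝ E] [TopologicalSpace E]
variable {κ : Type*}

/-- The polyhedron cut out by the inequalities `0 ≤ a i x + c i`. -/
def polyhedron (a : κ → E →L[ℝ] ℝ) (c : κ → ℝ) : Set E := {x | ∀ i, 0 ≤ a i x + c i}

/-- The inequalities that are equalities at `x`. -/
def activeSet (a : κ → E →L[ℝ] ℝ) (c : κ → ℝ) (x : E) : Set κ := {i | a i x + c i = 0}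

/-- The part of the polyhedron where the inequalities in `I` are equalities. -/
def activeFace (a : κ → E →L[ℝ] ℝ) (c : κ → ℝ) (I : Set κ) : Set E :=
  {x | x ∈ polyhedron a c ∧ I ⊆ activeSet a c x}

/-- The directions annihilated by the linear parts of the inequalities in `I`. -/
def activeDirection (a : κ → E →L[ℝ] ℝ) (I : Set κ) : Submodule ℝ E where
  carrier := {v | ∀ i ∈ I, a i v = 0}
  add_mem' := fun {v w} hv hw i hi => by rw [map_add, hv i hi, hw i hi, add_zero]
  zero_mem' := fun i _ => map_zero _
  smul_mem' := fun r v hv i hi => by rw [map_smul, hv i hi, smul_zero]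

variable {a : κ → E →L[ℝ] ℝ} {c : κ → ℝ}

theorem convex_polyhedron : Convex ℝ (polyhedron a c) := by
  intro x hx y hy s t hs ht hst i
  have h : a i (s • x + t • y) + c i = s * (a i x + c i) + t * (a i y + c i) := by
    simp only [map_add, map_smul, smul_eq_mul]
    linear_combination -c i * hst
  rw [h]
  exact add_nonneg (mul_nonneg hs (hx i)) (mul_nonneg ht (hy i))

/-- Tight inequalities do not change along `v`, and the finitely many strict ones survive a small
move by continuity. -/
theorem exists_pos_add_smul_mem [Finite κ] {x v : E} (hx : x ∈ polyhedron a c)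
    (hv : v ∈ activeDirection a (activeSet a c x)) :
    ∃ ε : ℝ, 0 < ε ∧ x + ε • v ∈ polyhedron a c := by
  have key : ∀ᶠ ε in nhdsWithin (0 : ℝ) (Set.Ioi 0), ∀ i, 0 ≤ a i (x + ε • v) + c i := by
    rw [Filter.eventually_all]
    intro i
    by_cases hi : i ∈ activeSet a c x
    · refine Filter.Eventually.of_forall fun ε => ?_
      have h1 : a i x + c i = 0 := hi
      rw [map_add, map_smul, hv i hi, smul_zero, add_zero, h1]
    · have hpos : 0 < a i x + c i := lt_of_le_of_ne (hx i) (Ne.symm hi)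
      have hc : Continuous fun ε : ℝ => a i x + ε * a i v + c i := by fun_prop
      have h0 := hc.tendsto 0
      rw [zero_mul, add_zero] at h0
      filter_upwards [(h0.eventually (lt_mem_nhds hpos)).filter_mono nhdsWithin_le_nhds] with ε hε
      rw [map_add, map_smul, smul_eq_mul]
      exact hε.le
  obtain ⟨ε, h1, h2⟩ := (key.and self_mem_nhdsWithin).exists
  exact ⟨ε, h2, h1⟩

theorem activeSet_add_smul {x v : E} (hv : v ∈ activeDirection a (activeSet a c x)) (ε : ℝ) :
    activeSet a c x ⊆ activeSet a c (x + ε • v) := by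
  intro i hi
  have h1 : a i x + c i = 0 := hi
  change a i (x + ε • v) + c i = 0
  rw [map_add, map_smul, hv i hi, smul_zero, add_zero, h1]

theorem sub_mem_activeDirection {I : Set κ} {x y : E} (hx : I ⊆ activeSet a c x)
    (hy : I ⊆ activeSet a c y) : x - y ∈ activeDirection a I := by
  intro i hi
  have h1 : a i x + c i = 0 := hx hi
  have h2 : a i y + c i = 0 := hy hi
  rw [map_sub]
  linarith

/-- Every nonempty exposed face of a polyhedron is the set where all inequalities active at a
suitable point of the face are equalities. -/
theorem exists_eq_activeFace [Finite κ] {F : Set E} (hF : IsExposed ℝ (polyhedron a c) F)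
    (hne : F.Nonempty) : ∃ x ∈ polyhedron a c, F = activeFace a c (activeSet a c x) := by
  -- A point of the face with minimal active set plays the role of a relative interior point.
  obtain ⟨_, ⟨x, hxF, rfl⟩, hmin⟩ := WellFounded.has_min
    (wellFounded_lt (α := Set κ)) (activeSet a c '' F) (hne.image _)
  have hFc : Convex ℝ F := hF.convex convex_polyhedron
  have hFP : F ⊆ polyhedron a c := hF.subset
  refine ⟨x, hFP hxF, Set.Subset.antisymm (fun y hy => ⟨hFP hy, ?_⟩) ?_⟩
  -- An inequality tight at the midpoint is tight at both ends, so minimality at `x` forces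
  -- everything tight at `x` to be tight at `y`.
  · have hm : (1 / 2 : ℝ) • x + (1 / 2 : ℝ) • y ∈ F :=
      hFc hxF hy (by norm_num) (by norm_num) (by norm_num)
    have hact : ∀ i ∈ activeSet a c ((1 / 2 : ℝ) • x + (1 / 2 : ℝ) • y),
        i ∈ activeSet a c x ∧ i ∈ activeSet a c y := by
      intro i hi
      have h1 : a i ((1 / 2 : ℝ) • x + (1 / 2 : ℝ) • y) + c i = 0 := hi
      simp only [map_add, map_smul, smul_eq_mul] at h1
      have h2 := hFP hxF i
      have h3 := hFP hy i
      exact ⟨show a i x + c i = 0 by linarith, show a i y + c i = 0 by linarith⟩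
    by_contra hxy
    refine hmin _ ⟨_, hm, rfl⟩ ⟨fun i hi => (hact i hi).1, fun h => hxy fun i hi => ?_⟩
    exact (hact i (h hi)).2
  · rintro y ⟨hyP, hy⟩
    -- The segment from `y` to `x` extends a little beyond `x` inside the polyhedron. Since `l` is
    -- maximal at `x`, it cannot increase from `y` to `x`, so `y` is a maximizer too.
    have hdir := sub_mem_activeDirection (le_refl (activeSet a c x)) hy
    obtain ⟨ε, hε, hmem⟩ := exists_pos_add_smul_mem (hFP hxF) hdir
    obtain ⟨l, rfl⟩ := hF hne
    have h1 := hxF.2 _ hmem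
    refine ⟨hyP, fun z hz => (hxF.2 z hz).trans ?_⟩
    rw [map_add, map_smul, map_sub, smul_eq_mul] at h1
    nlinarith

theorem isExposed_activeFace [IsTopologicalAddGroup E] [ContinuousSMul ℝ E] [Finite κ] (I : Set κ) :
    IsExposed ℝ (polyhedron a c) (activeFace a c I) := by
  classical
  rintro ⟨x, hxP, hx⟩
  have := Fintype.ofFinite κ
  -- Up to a constant this is minus the total slack of the inequalities in `I`; it is maximal
  -- exactly where all these slacks vanish.
  refine ⟨-∑ i ∈ I.toFinset, a i, ?_⟩
  have hval : ∀ y, (-∑ i ∈ I.toFinset, a i) y =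
      (∑ i ∈ I.toFinset, c i) - ∑ i ∈ I.toFinset, (a i y + c i) := by
    intro y
    simp [Finset.sum_add_distrib]
  have hzero : ∀ y, I ⊆ activeSet a c y → ∑ i ∈ I.toFinset, (a i y + c i) = 0 := fun y hy =>
    Finset.sum_eq_zero fun i hi => hy (Set.mem_toFinset.mp hi)
  ext y
  constructor
  · rintro ⟨hyP, hy⟩
    refine ⟨hyP, fun z hz => ?_⟩
    rw [hval, hval, hzero y hy]
    have : 0 ≤ ∑ i ∈ I.toFinset, (a i z + c i) := Finset.sum_nonneg fun i _ => hz i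
    linarith
  · rintro ⟨hyP, hy⟩
    refine ⟨hyP, fun i hi => ?_⟩
    have h1 := hy x hxP
    rw [hval, hval, hzero x hx] at h1
    have h2 : ∑ i ∈ I.toFinset, (a i y + c i) = 0 :=
      le_antisymm (by linarith) (Finset.sum_nonneg fun i _ => hyP i)
    exact (Finset.sum_eq_zero_iff_of_nonneg fun i _ => hyP i).mp h2 i (Set.mem_toFinset.mpr hi)

theorem activeFace_activeSet_inj {x y : E} (hx : x ∈ polyhedron a c) (hy : y ∈ polyhedron a c)
    (h : activeFace a c (activeSet a c x) = activeFace a c (activeSet a c y)) :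
    activeSet a c x = activeSet a c y := by
  have h1 : x ∈ activeFace a c (activeSet a c y) := h ▸ ⟨hx, le_refl _⟩
  have h2 : y ∈ activeFace a c (activeSet a c x) := h ▸ ⟨hy, le_refl _⟩
  exact Set.Subset.antisymm h2.2 h1.2

/-- From `x` one can move a positive distance within the face along any direction annihilated by the
tight linear parts. -/
theorem vectorSpan_activeFace [Finite κ] {x : E} (hx : x ∈ polyhedron a c) :
    vectorSpan ℝ (activeFace a c (activeSet a c x)) = activeDirection a (activeSet a c x) := by
  apply le_antisymm
  · rw [vectorSpan_def, Submodule.span_le]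
    rintro _ ⟨y, hy, z, hz, rfl⟩
    exact sub_mem_activeDirection hy.2 hz.2
  · intro v hv
    obtain ⟨ε, hε, hmem⟩ := exists_pos_add_smul_mem hx hv
    have h := vsub_mem_vectorSpan ℝ
      (show x + ε • v ∈ activeFace a c (activeSet a c x) from ⟨hmem, activeSet_add_smul hv ε⟩)
      (show x ∈ activeFace a c (activeSet a c x) from ⟨hx, le_refl _⟩)
    rw [vsub_eq_sub, add_sub_cancel_left] at h
    exact (Submodule.smul_mem_iff _ hε.ne').mp h

theorem setOf_isExposed_polyhedron [IsTopologicalAddGroup E] [ContinuousSMul ℝ E] [Finite κ] :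
    {F : Set E | IsExposed ℝ (polyhedron a c) F ∧ F.Nonempty} =
      activeFace a c '' (activeSet a c '' polyhedron a c) := by
  ext F
  constructor
  · rintro ⟨hF, hne⟩
    obtain ⟨x, hx, rfl⟩ := exists_eq_activeFace hF hne
    exact ⟨_, ⟨x, hx, rfl⟩, rfl⟩
  · rintro ⟨_, ⟨x, hx, rfl⟩, rfl⟩
    exact ⟨isExposed_activeFace _, x, hx, le_refl _⟩

/-- The `f`-polynomial as a sum over the nonempty faces. -/
theorem fPoly_eq_sum [FiniteDimensional ℝ E] {P : Set E} {s : Finset (Set E)}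
    (hs : ∀ F, F ∈ s ↔ IsExposed ℝ P F ∧ F.Nonempty) :
    fPoly P = ∑ F ∈ s, Polynomial.X ^ dim F := by
  have hcount : ∀ d, faceCount P d = (s.filter fun F => dim F = d).card := by
    intro d
    rw [faceCount, ← Set.ncard_coe_finset]
    congr 1
    ext F
    simp [hs, and_assoc]
  rw [← Finset.sum_fiberwise_of_maps_to (g := dim) (t := Finset.range (dim P + 1))]
  · refine Finset.sum_congr rfl fun d _ => ?_
    rw [hcount, Finset.sum_congr rfl (g := fun _ => Polynomial.X ^ d)]
    · simp
    · intro F hF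
      rw [(Finset.mem_filter.mp hF).2]
  -- No face has larger dimension than `P`, so truncating the sum at `dim P` loses nothing.
  · intro F hF
    have h : dim F ≤ dim P :=
      Submodule.finrank_mono (vectorSpan_mono ℝ ((hs F).mp hF).1.subset)
    rw [Finset.mem_range]
    omega

theorem fPoly_polyhedron [IsTopologicalAddGroup E] [ContinuousSMul ℝ E] [FiniteDimensional ℝ E]
    [Finite κ] {T : Finset (Set κ)} (hT : ∀ I, I ∈ T ↔ I ∈ activeSet a c '' polyhedron a c) :
    fPoly (polyhedron a c) =
      ∑ I ∈ T, Polynomial.X ^ Module.finrank ℝ (activeDirection a I) := by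
  classical
  rw [fPoly_eq_sum (s := T.image (activeFace a c)), Finset.sum_image]
  · refine Finset.sum_congr rfl fun I hI => ?_
    obtain ⟨x, hx, rfl⟩ := (hT I).mp hI
    rw [dim, vectorSpan_activeFace hx]
  · intro I hI J hJ h
    obtain ⟨x, hx, rfl⟩ := (hT I).mp hI
    obtain ⟨y, hy, rfl⟩ := (hT J).mp hJ
    exact activeFace_activeSet_inj hx hy h
  · intro F
    have h := Set.ext_iff.mp (setOf_isExposed_polyhedron (a := a) (c := c)) F
    rw [Set.mem_ofPred_eq] at h
    rw [h, Finset.mem_image]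
    simp only [hT]
    rfl

end Polyhedron

/-! ### Combinatorial equivalence under affine embeddings -/

section Embedding

variable {E : Type*} [AddCommGroup E] [Module ℝ E] [TopologicalSpace E]
variable {E' : Type*} [AddCommGroup E'] [Module ℝ E'] [TopologicalSpace E']

/-- The image of a set under an affine embedding (an injective continuous affine map that has a
continuous linear left inverse) is combinatorially equivalent to the set. -/
theorem combEquiv_image (φ : E → E') (φl : E →L[ℝ] E') (c : E') (ψ : E' →L[ℝ] E)
    (hφ : ∀ x, φ x = φl x + c) (hψ : ∀ x, ψ (φ x) = x) (P : Set E) :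
    CombEquiv (φ '' P) P := by
  have hinj : Function.Injective φ := Function.LeftInverse.injective hψ
  have himage : ∀ F, IsExposed ℝ P F → IsExposed ℝ (φ '' P) (φ '' F) := by
    rintro F hF hne
    obtain ⟨l, rfl⟩ := hF (Set.image_nonempty.mp hne)
    -- Functionals are pushed forward through the left inverse `ψ` and, below, pulled back through
    -- `φl`; the translation by `c` only adds a constant and does not affect maximizers.
    refine ⟨l.comp ψ, ?_⟩
    ext y
    constructor
    · rintro ⟨x, ⟨hx, hmax⟩, rfl⟩
      refine ⟨⟨x, hx, rfl⟩, ?_⟩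
      rintro _ ⟨z, hz, rfl⟩
      simpa [hψ] using hmax z hz
    · rintro ⟨⟨x, hx, rfl⟩, hmax⟩
      refine ⟨x, ⟨hx, fun z hz => ?_⟩, rfl⟩
      simpa [hψ] using hmax _ ⟨z, hz, rfl⟩
  have hpre : ∀ G, IsExposed ℝ (φ '' P) G → IsExposed ℝ P (φ ⁻¹' G) := by
    rintro G hG ⟨x₀, hx₀⟩
    obtain ⟨l, rfl⟩ := hG ⟨_, hx₀⟩
    refine ⟨l.comp φl, ?_⟩
    ext x
    constructor
    · rintro ⟨⟨x', hx', he⟩, hmax⟩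
      obtain rfl := hinj he
      refine ⟨hx', fun z hz => ?_⟩
      simpa [hφ] using hmax _ ⟨z, hz, rfl⟩
    · rintro ⟨hx, hmax⟩
      refine ⟨⟨x, hx, rfl⟩, ?_⟩
      rintro _ ⟨z, hz, rfl⟩
      simpa [hφ] using hmax z hz
  refine ⟨{ toFun := fun G => ⟨φ ⁻¹' G.1, hpre _ G.2⟩
            invFun := fun F => ⟨φ '' F.1, himage _ F.2⟩
            left_inv := fun G => Subtype.ext ?_
            right_inv := fun F => Subtype.ext (Set.preimage_image_eq _ hinj)
            map_rel_iff' := ?_ }⟩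
  · exact Set.image_preimage_eq_of_subset (G.2.subset.trans (Set.image_subset_range _ _))
  · intro G H
    change φ ⁻¹' G.1 ⊆ φ ⁻¹' H.1 ↔ G.1 ⊆ H.1
    exact Set.preimage_subset_preimage_iff (G.2.subset.trans (Set.image_subset_range _ _))

end Embedding

/-! ### The top row and the row below it -/

section Lists

/-- The partial sums `i_1 + … + i_j`. -/
def partialSum (i : ℕ → ℕ) (j : ℕ) : ℕ := ∑ q ∈ Finset.Icc 1 j, i q

theorem partialSum_zero (i : ℕ → ℕ) : partialSum i 0 = 0 := rfl

theorem partialSum_succ (i : ℕ → ℕ) (j : ℕ) :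
    partialSum i (j + 1) = partialSum i j + i (j + 1) :=
  Finset.sum_Icc_succ_top (by omega) _

theorem partialSum_mono (i : ℕ → ℕ) : Monotone (partialSum i) :=
  monotone_nat_of_le_succ fun j => by rw [partialSum_succ]; omega

theorem exists_partialSum_le_lt (i : ℕ → ℕ) {k n : ℕ} (h : n < partialSum i k) :
    ∃ q < k, partialSum i q ≤ n ∧ n < partialSum i (q + 1) := by
  induction k with
  | zero => simp [partialSum_zero] at h
  | succ k ih =>
    by_cases hn : n < partialSum i k
    · obtain ⟨q, hq, h1⟩ := ih hn
      exact ⟨q, by omega, h1⟩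
    · exact ⟨k, by omega, by omega, h⟩

/-- The blocks `q, …, q, c_q` of length `i_q`, for `q = 1, …, m`. -/
noncomputable def blocks (i : ℕ → ℕ) (c : ℕ → ℝ) (m : ℕ) : List ℝ :=
  (List.range' 1 m).flatMap fun q => List.replicate (i q - 1) (q : ℝ) ++ [c q]

/-- The sequence `1^{i_1-1} c_1 2^{i_2-1} c_2 … c_{k-1} k^{i_k-1}`. -/
noncomputable def belowRow (k : ℕ) (i : ℕ → ℕ) (c : ℕ → ℝ) : List ℝ :=
  blocks i c (k - 1) ++ List.replicate (i k - 1) (k : ℝ)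

theorem seq_succ (k : ℕ) (i : ℕ → ℕ) :
    seq (k + 1) i = seq k i ++ List.replicate (i (k + 1)) ((k : ℝ) + 1) := by
  simp [seq, List.range'_concat, add_comm]

theorem blocks_succ (i : ℕ → ℕ) (c : ℕ → ℝ) (m : ℕ) : blocks i c (m + 1) =
    blocks i c m ++ (List.replicate (i (m + 1) - 1) ((m : ℝ) + 1) ++ [c (m + 1)]) := by
  simp [blocks, List.range'_concat, add_comm]

theorem length_seq (k : ℕ) (i : ℕ → ℕ) : (seq k i).length = partialSum i k := by
  induction k with
  | zero => rfl
  | succ k ih => rw [seq_succ, partialSum_succ, List.length_append, ih, List.length_replicate]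

theorem length_blocks {m : ℕ} {i : ℕ → ℕ} (c : ℕ → ℝ) (hi : ∀ q ∈ Finset.Icc 1 m, 1 ≤ i q) :
    (blocks i c m).length = partialSum i m := by
  induction m with
  | zero => rfl
  | succ m ih =>
    have h := hi (m + 1) (by simp)
    rw [blocks_succ, partialSum_succ, List.length_append,
      ih fun q hq => hi q (by simp at hq ⊢; omega)]
    simp
    omega

theorem length_belowRow {k : ℕ} (hk : 1 ≤ k) {i : ℕ → ℕ} (c : ℕ → ℝ)
    (hi : ∀ q ∈ Finset.Icc 1 k, 1 ≤ i q) :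
    (belowRow k i c).length + 1 = partialSum i k := by
  obtain ⟨m, rfl⟩ : ∃ m, k = m + 1 := ⟨k - 1, by omega⟩
  have h := hi (m + 1) (by simp)
  rw [belowRow, List.length_append, Nat.add_sub_cancel,
    length_blocks c fun q hq => hi q (by simp at hq ⊢; omega), partialSum_succ]
  simp
  omega

theorem seq_getD (i : ℕ → ℕ) {k q n : ℕ} (hq : q < k) (h1 : partialSum i q ≤ n)
    (h2 : n < partialSum i (q + 1)) : (seq k i).getD n 0 = (q : ℝ) + 1 := by
  induction k with
  | zero => omega
  | succ k ih =>
    rw [seq_succ]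
    by_cases hqk : q < k
    · have := partialSum_mono i (show q + 1 ≤ k by omega)
      rw [List.getD_append _ _ _ _ (by rw [length_seq]; omega), ih hqk]
    · obtain rfl : q = k := by omega
      rw [partialSum_succ] at h2
      rw [List.getD_append_right _ _ _ _ (by rw [length_seq]; omega), length_seq,
        List.getD_eq_getElem _ _ (by rw [List.length_replicate]; omega), List.getElem_replicate]

/-- Indices are zero-based: block `q + 1` occupies the positions from `partialSum i q` to
`partialSum i (q + 1) - 1`, and the last of these is reserved for `c (q + 1)`. -/
theorem blocks_getD_of_lt {i : ℕ → ℕ} (c : ℕ → ℝ) {m q n : ℕ}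
    (hi : ∀ q ∈ Finset.Icc 1 m, 1 ≤ i q) (hq : q < m) (h1 : partialSum i q ≤ n)
    (h2 : n + 1 < partialSum i (q + 1)) : (blocks i c m).getD n 0 = (q : ℝ) + 1 := by
  induction m with
  | zero => omega
  | succ m ih =>
    have hi' : ∀ q ∈ Finset.Icc 1 m, 1 ≤ i q := fun q hq => hi q (by simp at hq ⊢; omega)
    rw [blocks_succ]
    by_cases hqm : q < m
    · have := partialSum_mono i (show q + 1 ≤ m by omega)
      rw [List.getD_append _ _ _ _ (by rw [length_blocks c hi']; omega), ih hi' hqm]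
    · obtain rfl : q = m := by omega
      rw [partialSum_succ] at h2
      rw [List.getD_append_right _ _ _ _ (by rw [length_blocks c hi']; omega), length_blocks c hi',
        List.getD_append _ _ _ _ (by rw [List.length_replicate]; omega),
        List.getD_eq_getElem _ _ (by rw [List.length_replicate]; omega), List.getElem_replicate]

theorem blocks_getD_of_eq {i : ℕ → ℕ} (c : ℕ → ℝ) {m q n : ℕ}
    (hi : ∀ q ∈ Finset.Icc 1 m, 1 ≤ i q) (hq : q < m)
    (h2 : n + 1 = partialSum i (q + 1)) : (blocks i c m).getD n 0 = c (q + 1) := by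
  induction m with
  | zero => omega
  | succ m ih =>
    have hi' : ∀ q ∈ Finset.Icc 1 m, 1 ≤ i q := fun q hq => hi q (by simp at hq ⊢; omega)
    rw [blocks_succ]
    by_cases hqm : q < m
    · have := partialSum_mono i (show q + 1 ≤ m by omega)
      rw [List.getD_append _ _ _ _ (by rw [length_blocks c hi']; omega), ih hi' hqm]
    · obtain rfl : q = m := by omega
      have h := hi (q + 1) (by simp)
      rw [partialSum_succ] at h2
      rw [List.getD_append_right _ _ _ _ (by rw [length_blocks c hi']; omega), length_blocks c hi',
        List.getD_append_right _ _ _ _ (by rw [List.length_replicate]; omega),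
        List.length_replicate, show n - partialSum i q - (i (q + 1) - 1) = 0 by omega]
      rfl

variable {k : ℕ} {i : ℕ → ℕ}

theorem belowRow_getD_of_lt (hi : ∀ q ∈ Finset.Icc 1 k, 1 ≤ i q) (c : ℕ → ℝ) {q n : ℕ}
    (hq : q < k) (h1 : partialSum i q ≤ n) (h2 : n + 1 < partialSum i (q + 1)) :
    (belowRow k i c).getD n 0 = (q : ℝ) + 1 := by
  obtain ⟨m, rfl⟩ : ∃ m, k = m + 1 := ⟨k - 1, by omega⟩
  have hi' : ∀ q ∈ Finset.Icc 1 m, 1 ≤ i q := fun q hq => hi q (by simp at hq ⊢; omega)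
  rw [belowRow, Nat.add_sub_cancel]
  by_cases hqm : q < m
  · have := partialSum_mono i (show q + 1 ≤ m by omega)
    rw [List.getD_append _ _ _ _ (by rw [length_blocks c hi']; omega),
      blocks_getD_of_lt c hi' hqm h1 h2]
  · obtain rfl : q = m := by omega
    rw [partialSum_succ] at h2
    rw [List.getD_append_right _ _ _ _ (by rw [length_blocks c hi']; omega), length_blocks c hi',
        List.getD_eq_getElem _ _ (by rw [List.length_replicate]; omega), List.getElem_replicate]
    push_cast
    rfl

theorem belowRow_getD_of_eq (hi : ∀ q ∈ Finset.Icc 1 k, 1 ≤ i q) (c : ℕ → ℝ) {q n : ℕ}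
    (hq : q + 1 < k) (h : n + 1 = partialSum i (q + 1)) :
    (belowRow k i c).getD n 0 = c (q + 1) := by
  obtain ⟨m, rfl⟩ : ∃ m, k = m + 1 := ⟨k - 1, by omega⟩
  have hi' : ∀ q ∈ Finset.Icc 1 m, 1 ≤ i q := fun q hq => hi q (by simp at hq ⊢; omega)
  have := partialSum_mono i (show q + 1 ≤ m by omega)
  rw [belowRow, Nat.add_sub_cancel, List.getD_append _ _ _ _ (by rw [length_blocks c hi']; omega),
    blocks_getD_of_eq c hi' (by omega) h]

/-- Position `n` of the row below is either strictly inside a block of equal numbers, or between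
two such blocks. -/
theorem position_cases (hi : ∀ q ∈ Finset.Icc 1 k, 1 ≤ i q) (c : ℕ → ℝ) {n : ℕ}
    (hn : n + 1 < partialSum i k) :
    (∃ q < k, (seq k i).getD n 0 = (q : ℝ) + 1 ∧ (seq k i).getD (n + 1) 0 = (q : ℝ) + 1 ∧
      (belowRow k i c).getD n 0 = (q : ℝ) + 1) ∨
    ∃ q ∈ Finset.Ico 1 k, n + 1 = partialSum i q ∧ (seq k i).getD n 0 = (q : ℝ) ∧
      (seq k i).getD (n + 1) 0 = (q : ℝ) + 1 ∧ (belowRow k i c).getD n 0 = c q := by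
  obtain ⟨q, hq, h1, h2⟩ := exists_partialSum_le_lt i (show n < partialSum i k by omega)
  by_cases h : n + 1 < partialSum i (q + 1)
  · exact Or.inl ⟨q, hq, seq_getD i hq h1 h2, seq_getD i hq (by omega) h,
      belowRow_getD_of_lt hi c hq h1 h⟩
  · have h3 : n + 1 = partialSum i (q + 1) := by omega
    have hqk : q + 1 < k := by
      by_contra hcon
      obtain rfl : q + 1 = k := by omega
      omega
    have h4 := hi (q + 1 + 1) (by simp; omega)
    refine Or.inr ⟨q + 1, by simp; omega, h3, ?_, ?_, belowRow_getD_of_eq hi c hqk h3⟩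
    · rw [seq_getD i hq h1 h2]
      push_cast
      rfl
    · exact seq_getD i hqk (by omega) (by rw [partialSum_succ i (q + 1)]; omega)

theorem partialSum_pos_lt (hi : ∀ q ∈ Finset.Icc 1 k, 1 ≤ i q) {q : ℕ} (hq : q ∈ Finset.Ico 1 k) :
    1 ≤ partialSum i q ∧ 1 + partialSum i q ≤ partialSum i k := by
  rw [Finset.mem_Ico] at hq
  obtain ⟨m, rfl⟩ : ∃ m, q = m + 1 := ⟨q - 1, by omega⟩
  have h1 := hi (m + 1) (by simp; omega)
  have h2 := hi (m + 1 + 1) (by simp; omega)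
  have h3 := partialSum_mono i (show m + 1 + 1 ≤ k by omega)
  rw [partialSum_succ i (m + 1)] at h3
  have := partialSum_succ i m
  omega

theorem getD_partialSum (hi : ∀ q ∈ Finset.Icc 1 k, 1 ≤ i q) (c : ℕ → ℝ) {q : ℕ}
    (hq : q ∈ Finset.Ico 1 k) :
    (seq k i).getD (partialSum i q - 1) 0 = (q : ℝ) ∧
      (seq k i).getD (partialSum i q) 0 = (q : ℝ) + 1 ∧
      (belowRow k i c).getD (partialSum i q - 1) 0 = c q := by
  have hpos := partialSum_pos_lt hi hq
  rw [Finset.mem_Ico] at hq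
  obtain ⟨m, rfl⟩ : ∃ m, q = m + 1 := ⟨q - 1, by omega⟩
  have h1 := hi (m + 1) (by simp; omega)
  have h2 := hi (m + 1 + 1) (by simp; omega)
  have h3 := partialSum_succ i m
  refine ⟨?_, ?_, ?_⟩
  · rw [seq_getD i (q := m) (by omega) (by omega) (by omega)]
    push_cast
    rfl
  · exact seq_getD i hq.2 le_rfl (by rw [partialSum_succ i (m + 1)]; omega)
  · exact belowRow_getD_of_eq hi c hq.2 (by omega)

theorem belowRow_interlacing (hi : ∀ q ∈ Finset.Icc 1 k, 1 ≤ i q) {c : ℕ → ℝ}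
    (hc : ∀ q ∈ Finset.Ico 1 k, (q : ℝ) ≤ c q ∧ c q ≤ (q : ℝ) + 1) {n : ℕ}
    (hn : n + 1 < partialSum i k) :
    (seq k i).getD n 0 ≤ (belowRow k i c).getD n 0 ∧
      (belowRow k i c).getD n 0 ≤ (seq k i).getD (n + 1) 0 := by
  rcases position_cases hi c hn with ⟨q, -, h1, h2, h3⟩ | ⟨q, hq, -, h1, h2, h3⟩
  · rw [h1, h2, h3]
    exact ⟨le_rfl, le_rfl⟩
  · rw [h1, h2, h3]
    exact hc q hq

/-- Consecutive entries of the lower row are separated by the entry of the top row above them. -/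
theorem belowRow_step (hk : 1 ≤ k) (hi : ∀ q ∈ Finset.Icc 1 k, 1 ≤ i q) {c : ℕ → ℝ}
    (hc : ∀ q ∈ Finset.Ico 1 k, (q : ℝ) ≤ c q ∧ c q ≤ (q : ℝ) + 1) {n : ℕ}
    (hn : n + 1 < (belowRow k i c).length) :
    (belowRow k i c).getD n 0 ≤ (belowRow k i c).getD (n + 1) 0 := by
  have hl := length_belowRow hk c hi
  exact (belowRow_interlacing hi hc (by omega)).2.trans (belowRow_interlacing hi hc (by omega)).1

theorem pairwise_belowRow (hk : 1 ≤ k) (hi : ∀ q ∈ Finset.Icc 1 k, 1 ≤ i q) {c : ℕ → ℝ}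
    (hc : ∀ q ∈ Finset.Ico 1 k, (q : ℝ) ≤ c q ∧ c q ≤ (q : ℝ) + 1) :
    (belowRow k i c).Pairwise (· ≤ ·) := by
  rw [← List.isChain_iff_pairwise, List.isChain_iff_getElem]
  intro n hn
  have h := belowRow_step hk hi hc hn
  rwa [List.getD_eq_getElem _ _ (by omega), List.getD_eq_getElem _ _ hn] at h

theorem pairwise_reducedSeq (k : ℕ) (i : ℕ → ℕ) (α : ℕ →₀ ℕ) :
    (reducedSeq k i α).Pairwise (· ≤ ·) := by
  rw [reducedSeq, List.pairwise_flatMap]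
  refine ⟨fun n _ => by simp [List.pairwise_replicate], ?_⟩
  refine (List.pairwise_lt_range').imp fun {m n} hmn x hx y hy => ?_
  rw [List.eq_of_mem_replicate hx, List.eq_of_mem_replicate hy]
  have : (m : ℝ) < n := Nat.cast_lt.mpr hmn
  linarith

theorem coe_flatMap_range' {β : Type*} (f : ℕ → List β) (s m : ℕ) :
    (((List.range' s m).flatMap f : List β) : Multiset β) =
      ∑ q ∈ Finset.Ico s (s + m), (f q : Multiset β) := by
  induction m with
  | zero => simp
  | succ m ih =>
    rw [List.range'_concat, ← add_assoc, Finset.sum_Ico_succ_top (by omega), ← ih,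
      List.flatMap_append, ← Multiset.coe_add]
    simp

/-- Double counting: `exponent e n` is the number of `j` with `2 * j + e j = n`, so exchanging the
sums leaves each barycenter coordinate exactly once. -/
theorem sum_exponent_nsmul (e : Finset.Ico 1 k → Fin 3) :
    ∑ n ∈ Finset.Ico 2 (2 * k + 1), Multiset.replicate (exponent e n) ((n : ℝ) / 2) =
      ∑ j : Finset.Ico 1 k, {(j : ℝ) + ((e j : ℕ) : ℝ) / 2} := by
  have h : ∀ n, Multiset.replicate (exponent e n) ((n : ℝ) / 2) =
      ∑ j : Finset.Ico 1 k, if 2 * (j : ℕ) + (e j : ℕ) = n then {(n : ℝ) / 2} else 0 := by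
    intro n
    rw [← Multiset.nsmul_singleton, exponent, Finsupp.finsetSum_apply, Finset.sum_smul]
    refine Finset.sum_congr rfl fun j _ => ?_
    rw [Finsupp.single_apply]
    split_ifs <;> simp
  simp_rw [h]
  rw [Finset.sum_comm]
  refine Finset.sum_congr rfl fun j _ => ?_
  have hj := Finset.mem_Ico.mp j.2
  have he := (e j).isLt
  rw [Finset.sum_ite_eq, if_pos (by simp; omega)]
  push_cast
  congr 1
  ring

/-- Both lists are sorted, so it suffices to compare multisets: the integers with multiplicity `i q
- 1` match, and the exponents account for the values `c j`. -/
theorem reducedSeq_exponent (hk : 1 ≤ k) (hi : ∀ q ∈ Finset.Icc 1 k, 1 ≤ i q)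
    (e : Finset.Ico 1 k → Fin 3) {c : ℕ → ℝ}
    (hc : ∀ j : Finset.Ico 1 k, c j = (j : ℝ) + ((e j : ℕ) : ℝ) / 2) :
    reducedSeq k i (exponent e) = belowRow k i c := by
  have hcb : ∀ q ∈ Finset.Ico 1 k, (q : ℝ) ≤ c q ∧ c q ≤ (q : ℝ) + 1 := by
    intro q hq
    have h1 : c q = _ := hc ⟨q, hq⟩
    have h2 : ((e ⟨q, hq⟩ : ℕ) : ℝ) ≤ 2 := by exact_mod_cast Nat.le_of_lt_succ (e ⟨q, hq⟩).isLt
    have h3 : (0 : ℝ) ≤ ((e ⟨q, hq⟩ : ℕ) : ℝ) := Nat.cast_nonneg _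
    constructor <;> linarith
  refine List.Perm.eq_of_pairwise' (pairwise_reducedSeq _ _ _) (pairwise_belowRow hk hi hcb) ?_
  rw [← Multiset.coe_eq_coe, reducedSeq, coe_flatMap_range', belowRow, blocks, ← Multiset.coe_add,
    coe_flatMap_range']
  have hsplit : ∀ n, ((List.replicate (if Even n then i (n / 2) - 1 + exponent e n
      else exponent e n) ((n : ℝ) / 2) : List ℝ) : Multiset ℝ) =
      (if Even n then Multiset.replicate (i (n / 2) - 1) ((n : ℝ) / 2) else 0) +
      Multiset.replicate (exponent e n) ((n : ℝ) / 2) := by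
    intro n
    rw [Multiset.coe_replicate]
    split_ifs
    · rw [Multiset.replicate_add]
    · rw [zero_add]
  have hsplit' : ∀ q, ((List.replicate (i q - 1) (q : ℝ) ++ [c q] : List ℝ) : Multiset ℝ) =
      Multiset.replicate (i q - 1) (q : ℝ) + {c q} := by
    intro q
    rw [← Multiset.coe_add, Multiset.coe_replicate, Multiset.coe_singleton]
  simp_rw [hsplit, hsplit']
  rw [Finset.sum_add_distrib, Finset.sum_add_distrib, show 2 + (2 * k - 1) = 2 * k + 1 by omega,
    show 1 + (k - 1) = k by omega, sum_exponent_nsmul, Multiset.coe_replicate, add_right_comm]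
  congr 1
  -- Only even `n = 2 * q` carry the multiplicities `i q - 1`.
  · rw [← Finset.sum_Ico_succ_top hk fun q => Multiset.replicate (i q - 1) (q : ℝ),
      ← Finset.sum_filter]
    symm
    refine Finset.sum_nbij' (fun q => 2 * q) (fun n => n / 2) ?_ ?_ ?_ ?_ ?_
    · intro q hq
      simp at hq ⊢
      omega
    · intro n hn
      simp at hn ⊢
      omega
    · intro q _
      omega
    · intro n hn
      exact Nat.mul_div_cancel' (Finset.mem_filter.mp hn).2.two_dvd
    · intro q _
      rw [Nat.mul_div_cancel_left q (by norm_num)]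
      push_cast
      congr 1
      ring
  · rw [← Finset.sum_coe_sort (Finset.Ico 1 k) fun q => ({c q} : Multiset ℝ)]
    exact Finset.sum_congr rfl fun j _ => by rw [hc j]

end Lists

/-! ### Gelfand–Tsetlin tables, their inequalities and patterns -/

section Tables

/-- The unknown in position `(a, b)` as a linear functional (zero outside of the table). -/
noncomputable def entryLin (s a b : ℕ) : (Idx s → ℝ) →L[ℝ] ℝ :=
  if h : 1 ≤ a ∧ 1 ≤ b ∧ a + b ≤ s then ContinuousLinearMap.proj ⟨(a, b), h⟩ else 0

/-- The contribution of the top row to the entry in position `(a, b)`. -/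
noncomputable def topEntry (l : List ℝ) (a b : ℕ) : ℝ := if a = 0 then l.getD (b - 1) 0 else 0

theorem entryLin_of_mem {s a b : ℕ} (h : 1 ≤ a ∧ 1 ≤ b ∧ a + b ≤ s) (u : Idx s → ℝ) :
    entryLin s a b u = u ⟨(a, b), h⟩ := by
  rw [entryLin, dif_pos h]
  rfl

theorem entryLin_zero (s b : ℕ) : entryLin s 0 b = 0 := dif_neg (by omega)

theorem entry_eq (l : List ℝ) (u : Idx l.length → ℝ) (a b : ℕ) :
    entry l u a b = entryLin l.length a b u + topEntry l a b := by
  unfold entry entryLin topEntry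
  split_ifs with h1 h2 h2
  · omega
  · simp
  · simp
  · simp

theorem entry_zero (l : List ℝ) (u : Idx l.length → ℝ) (b : ℕ) :
    entry l u 0 b = l.getD (b - 1) 0 := if_pos rfl

theorem entry_of_mem {l : List ℝ} {a b : ℕ} (h : 1 ≤ a ∧ 1 ≤ b ∧ a + b ≤ l.length)
    (u : Idx l.length → ℝ) : entry l u a b = u ⟨(a, b), h⟩ := by
  rw [entry, if_neg (by omega), dif_pos h]

/-- The linear parts of the inequalities of a Gelfand–Tsetlin polytope: `(p, false)` compares the
entry in position `p` to its left upper neighbour, `(p, true)` to its right upper neighbour. -/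
noncomputable def ineqLin (s : ℕ) (x : Idx s × Bool) : (Idx s → ℝ) →L[ℝ] ℝ :=
  (if x.2 then (-1 : ℝ) else 1) •
    (ContinuousLinearMap.proj x.1 - entryLin s (x.1.1.1 - 1) (x.1.1.2 + x.2.toNat))

/-- The constant parts of the inequalities of a Gelfand–Tsetlin polytope. -/
noncomputable def ineqConst (l : List ℝ) (x : Idx l.length × Bool) : ℝ :=
  (if x.2 then (-1 : ℝ) else 1) * -topEntry l (x.1.1.1 - 1) (x.1.1.2 + x.2.toNat)

theorem ineqLin_add_ineqConst (l : List ℝ) (u : Idx l.length → ℝ) (x : Idx l.length × Bool) :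
    ineqLin l.length x u + ineqConst l x =
      (if x.2 then (-1 : ℝ) else 1) *
        (u x.1 - entry l u (x.1.1.1 - 1) (x.1.1.2 + x.2.toNat)) := by
  rw [entry_eq, ineqLin, ineqConst]
  simp only [smul_apply, sub_apply,
    ContinuousLinearMap.proj_apply, smul_eq_mul]
  ring

theorem polytope_eq_polyhedron (l : List ℝ) :
    polytope l = polyhedron (ineqLin l.length) (ineqConst l) := by
  ext u
  simp only [polytope, polyhedron, Set.mem_ofPred_eq, ineqLin_add_ineqConst, Prod.forall,
    Bool.forall_bool]
  refine forall_congr' fun p => ?_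
  simp

/-- The equalities that hold at a point of a Gelfand–Tsetlin polytope. -/
def pattern (l : List ℝ) (u : Idx l.length → ℝ) : Set (Idx l.length × Bool) :=
  {x | u x.1 = entry l u (x.1.1.1 - 1) (x.1.1.2 + x.2.toNat)}

theorem activeSet_ineq (l : List ℝ) : activeSet (ineqLin l.length) (ineqConst l) = pattern l := by
  funext u
  ext ⟨p, β⟩
  simp only [activeSet, pattern, Set.mem_ofPred_eq, ineqLin_add_ineqConst]
  cases β <;> simp [sub_eq_zero, eq_comm]

/-- The tables with zero top row that satisfy the equalities in `I`. -/
noncomputable abbrev direction (s : ℕ) (I : Set (Idx s × Bool)) : Submodule ℝ (Idx s → ℝ) :=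
  activeDirection (ineqLin s) I

theorem mem_direction {s : ℕ} {I : Set (Idx s × Bool)} {v : Idx s → ℝ} :
    v ∈ direction s I ↔ ∀ x ∈ I, v x.1 = entryLin s (x.1.1.1 - 1) (x.1.1.2 + x.2.toNat) v := by
  change (∀ x ∈ I, ineqLin s x v = 0) ↔ _
  refine forall₂_congr fun x _ => ?_
  rw [ineqLin, smul_apply, smul_eq_mul, mul_eq_zero_iff_left,
    sub_apply, sub_eq_zero]
  · rfl
  · split_ifs <;> norm_num

theorem nonempty_polytope {l : List ℝ}
    (hl : ∀ n, n + 1 < l.length → l.getD n 0 ≤ l.getD (n + 1) 0) : (polytope l).Nonempty := by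
  -- The witness repeats the top entry λ_b for every unknown u_{a,b}, whatever `a` is.
  refine ⟨fun p => l.getD (p.1.2 - 1) 0, fun p => ?_⟩
  obtain ⟨⟨a, b⟩, h1, h2, h3⟩ := p
  dsimp only at h1 h2 h3 ⊢
  have hstep := hl (b - 1) (by omega)
  rw [Nat.sub_add_cancel h2] at hstep
  obtain rfl | ha : a = 1 ∨ 1 ≤ a - 1 := by omega
  · rw [Nat.sub_self, entry_zero, entry_zero]
    exact ⟨le_rfl, hstep⟩
  · rw [entry_of_mem (by omega), entry_of_mem (by omega)]
    exact ⟨le_rfl, hstep⟩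

/-! ### Adding a row at the top -/

/-- The table with the row `l'` and the unknowns `w` placed below a top row of length `s`. -/
noncomputable def lift (l' : List ℝ) (s : ℕ) (w : Idx l'.length → ℝ) : Idx s → ℝ :=
  fun p => entry l' w (p.1.1 - 1) p.1.2

/-- The linear part of `lift`. -/
noncomputable def liftLin (r s : ℕ) : (Idx r → ℝ) →L[ℝ] (Idx s → ℝ) :=
  ContinuousLinearMap.pi fun p => entryLin r (p.1.1 - 1) p.1.2

/-- Forgetting the first row of unknowns. -/
noncomputable def dropRow (r s : ℕ) : (Idx s → ℝ) →L[ℝ] (Idx r → ℝ) :=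
  ContinuousLinearMap.pi fun p => entryLin s (p.1.1 + 1) p.1.2

/-- The position one row lower. -/
def shift {r s : ℕ} (h : s = r + 1) (p : Idx r) : Idx s :=
  ⟨(p.1.1 + 1, p.1.2), by have := p.2; omega⟩

theorem shift_injective {r s : ℕ} (h : s = r + 1) : Function.Injective (shift h) := by
  intro p q hpq
  have h1 := congrArg (fun x : Idx s => x.1) hpq
  simp only [shift, Prod.mk.injEq, Nat.add_right_cancel_iff] at h1
  exact Subtype.ext (Prod.ext h1.1 h1.2)

theorem first_row_or_shift {r s : ℕ} (h : s = r + 1) (p : Idx s) :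
    p.1.1 = 1 ∨ ∃ q, shift h q = p := by
  obtain ⟨⟨a, b⟩, h1, h2, h3⟩ := p
  dsimp only at h1 h2 h3
  by_cases ha : a = 1
  · exact Or.inl ha
  · refine Or.inr ⟨⟨(a - 1, b), by dsimp only; omega⟩, Subtype.ext (Prod.ext ?_ rfl)⟩
    change a - 1 + 1 = a
    omega

theorem shift_ne_one {r s : ℕ} (h : s = r + 1) (p : Idx r) : (shift h p).1.1 ≠ 1 := by
  have := p.2.1
  change p.1.1 + 1 ≠ 1
  omega

theorem lift_eq (l' : List ℝ) (s : ℕ) (w : Idx l'.length → ℝ) :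
    lift l' s w = liftLin l'.length s w + fun p : Idx s => topEntry l' (p.1.1 - 1) p.1.2 := by
  funext p
  exact entry_eq _ _ _ _

theorem lift_of_first {l' : List ℝ} {s : ℕ} (w : Idx l'.length → ℝ) {p : Idx s} (hp : p.1.1 = 1) :
    lift l' s w p = l'.getD (p.1.2 - 1) 0 := by
  rw [lift, hp, Nat.sub_self, entry_zero]

theorem liftLin_of_first {r s : ℕ} (w : Idx r → ℝ) {p : Idx s} (hp : p.1.1 = 1) :
    liftLin r s w p = 0 := by
  change entryLin r (p.1.1 - 1) p.1.2 w = 0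
  rw [hp, Nat.sub_self, entryLin_zero]
  rfl

theorem liftLin_shift {r s : ℕ} (h : s = r + 1) (w : Idx r → ℝ) (p : Idx r) :
    liftLin r s w (shift h p) = w p :=
  entryLin_of_mem p.2 w

theorem lift_shift {l' : List ℝ} {s : ℕ} (h : s = l'.length + 1) (w : Idx l'.length → ℝ)
    (p : Idx l'.length) : lift l' s w (shift h p) = w p :=
  entry_of_mem p.2 w

theorem dropRow_apply {r s : ℕ} (h : s = r + 1) (u : Idx s → ℝ) (p : Idx r) :
    dropRow r s u p = u (shift h p) :=
  entryLin_of_mem (shift h p).2 u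

theorem entryLin_liftLin {r s : ℕ} (w : Idx r → ℝ) {a b : ℕ}
    (hab : 1 ≤ a ∧ 1 ≤ b ∧ a + b ≤ s) :
    entryLin s a b (liftLin r s w) = entryLin r (a - 1) b w := by
  rw [entryLin_of_mem hab]
  rfl

variable {l l' : List ℝ}

theorem entry_lift (w : Idx l'.length → ℝ) {a b : ℕ} (hab : 1 ≤ a ∧ 1 ≤ b ∧ a + b ≤ l.length) :
    entry l (lift l' l.length w) a b = entry l' w (a - 1) b := by
  rw [entry_of_mem hab]
  rfl

theorem dropRow_lift {s : ℕ} (h : s = l'.length + 1) (w : Idx l'.length → ℝ) :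
    dropRow l'.length s (lift l' s w) = w := by
  funext p
  rw [dropRow_apply h, lift_shift]

theorem lift_dropRow {s : ℕ} (h : s = l'.length + 1) {u : Idx s → ℝ}
    (hu : ∀ p : Idx s, p.1.1 = 1 → u p = l'.getD (p.1.2 - 1) 0) :
    lift l' s (dropRow l'.length s u) = u := by
  funext p
  rcases first_row_or_shift h p with hp | ⟨q, rfl⟩
  · rw [lift_of_first _ hp, hu p hp]
  · rw [lift_shift, dropRow_apply]

theorem entry_lift_above_shift (h : l.length = l'.length + 1) (w : Idx l'.length → ℝ)
    (p : Idx l'.length) {b : ℕ} (hb : b ≤ 1) :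
    entry l (lift l' l.length w) ((shift h p).1.1 - 1) ((shift h p).1.2 + b) =
      entry l' w (p.1.1 - 1) (p.1.2 + b) := by
  have hp := p.2
  exact entry_lift w (by change 1 ≤ p.1.1 + 1 - 1 ∧ 1 ≤ p.1.2 + b ∧
    p.1.1 + 1 - 1 + (p.1.2 + b) ≤ l.length; omega)

/-- The inequalities for the first row of unknowns are the interlacing hypothesis; all others are
the inequalities of the table below `l'`. -/
theorem lift_mem_polytope_iff (h : l.length = l'.length + 1)
    (hll : ∀ n < l'.length, l.getD n 0 ≤ l'.getD n 0 ∧ l'.getD n 0 ≤ l.getD (n + 1) 0)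
    (w : Idx l'.length → ℝ) : lift l' l.length w ∈ polytope l ↔ w ∈ polytope l' := by
  have key : ∀ p, (entry l (lift l' l.length w) ((shift h p).1.1 - 1) (shift h p).1.2 ≤
      lift l' l.length w (shift h p) ∧ lift l' l.length w (shift h p) ≤
      entry l (lift l' l.length w) ((shift h p).1.1 - 1) ((shift h p).1.2 + 1)) ↔
      (entry l' w (p.1.1 - 1) p.1.2 ≤ w p ∧ w p ≤ entry l' w (p.1.1 - 1) (p.1.2 + 1)) := by
    intro p
    have h0 := entry_lift_above_shift h w p (b := 0) (by omega)
    rw [add_zero, add_zero] at h0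
    rw [h0, entry_lift_above_shift h w p le_rfl, lift_shift]
  constructor
  · exact fun hw p => (key p).mp (hw (shift h p))
  · intro hw p
    rcases first_row_or_shift h p with hp | ⟨q, rfl⟩
    · rw [lift_of_first _ hp, hp, Nat.sub_self, entry_zero, entry_zero, Nat.add_sub_cancel]
      have hp2 := p.2
      have := hll (p.1.2 - 1) (by omega)
      rwa [Nat.sub_add_cancel hp2.2.1] at this
    · exact (key q).mpr (hw q)

theorem image_lift_polytope (h : l.length = l'.length + 1)
    (hll : ∀ n < l'.length, l.getD n 0 ≤ l'.getD n 0 ∧ l'.getD n 0 ≤ l.getD (n + 1) 0) :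
    lift l' l.length '' polytope l' =
      {u | u ∈ polytope l ∧
        ∀ p : Idx l.length, p.1.1 = 1 → u p = l'.getD (p.1.2 - 1) 0} := by
  ext u
  constructor
  · rintro ⟨w, hw, rfl⟩
    exact ⟨(lift_mem_polytope_iff h hll w).mpr hw, fun p hp => lift_of_first w hp⟩
  · rintro ⟨hu, h1⟩
    have hlift := lift_dropRow h h1
    exact ⟨_, (lift_mem_polytope_iff h hll _).mp (by rwa [hlift]), hlift⟩

theorem combEquiv_image_lift {s : ℕ} (h : s = l'.length + 1) :
    CombEquiv (lift l' s '' polytope l') (polytope l') :=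
  combEquiv_image _ (liftLin l'.length s) _ (dropRow l'.length s) (fun w => lift_eq l' s w)
    (dropRow_lift h) _

/-- The pattern of `lift l' l.length w` in terms of the pattern of `w`. -/
def extendPattern (h : l.length = l'.length + 1) (I : Set (Idx l'.length × Bool)) :
    Set (Idx l.length × Bool) :=
  {x | x.1.1.1 = 1 ∧ l'.getD (x.1.1.2 - 1) 0 = l.getD (x.1.1.2 + x.2.toNat - 1) 0} ∪
    Prod.map (shift h) id '' I

theorem shift_mem_extendPattern (h : l.length = l'.length + 1) (I : Set (Idx l'.length × Bool))
    (p : Idx l'.length) (β : Bool) : (shift h p, β) ∈ extendPattern h I ↔ (p, β) ∈ I := by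
  constructor
  · rintro (⟨h1, -⟩ | ⟨⟨q, γ⟩, hq, he⟩)
    · exact absurd h1 (shift_ne_one h p)
    · rw [Prod.map_apply, Prod.mk.injEq] at he
      obtain ⟨h1, rfl⟩ := he
      rwa [← shift_injective h h1]
  · exact fun hI => Or.inr ⟨_, hI, rfl⟩

theorem first_mem_extendPattern (h : l.length = l'.length + 1) (I : Set (Idx l'.length × Bool))
    {p : Idx l.length} (hp : p.1.1 = 1) (β : Bool) : (p, β) ∈ extendPattern h I ↔
      l'.getD (p.1.2 - 1) 0 = l.getD (p.1.2 + β.toNat - 1) 0 := by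
  constructor
  · rintro (h1 | ⟨⟨q, γ⟩, -, he⟩)
    · exact h1.2
    · rw [Prod.map_apply, Prod.mk.injEq] at he
      rw [← he.1] at hp
      exact absurd hp (shift_ne_one h q)
  · exact fun h1 => Or.inl ⟨hp, h1⟩

theorem extendPattern_injective (h : l.length = l'.length + 1) :
    Function.Injective (extendPattern h) := by
  intro I J hIJ
  ext ⟨p, β⟩
  rw [← shift_mem_extendPattern h, hIJ, shift_mem_extendPattern h]

theorem pattern_lift (h : l.length = l'.length + 1) (w : Idx l'.length → ℝ) :
    pattern l (lift l' l.length w) = extendPattern h (pattern l' w) := by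
  ext ⟨p, β⟩
  rcases first_row_or_shift h p with hp | ⟨q, rfl⟩
  · rw [first_mem_extendPattern h _ hp, pattern, Set.mem_ofPred_eq, lift_of_first w hp, hp,
      Nat.sub_self, entry_zero]
  · rw [shift_mem_extendPattern, pattern, Set.mem_ofPred_eq, lift_shift,
      entry_lift_above_shift h w q (Bool.toNat_le β)]
    rfl

theorem liftLin_dropRow {r s : ℕ} (h : s = r + 1) {v : Idx s → ℝ}
    (hv : ∀ p : Idx s, p.1.1 = 1 → v p = 0) : liftLin r s (dropRow r s v) = v := by
  funext p
  rcases first_row_or_shift h p with hp | ⟨q, rfl⟩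
  · rw [liftLin_of_first _ hp, hv p hp]
  · rw [liftLin_shift, dropRow_apply]

theorem liftLin_injective {r s : ℕ} (h : s = r + 1) : Function.Injective (liftLin r s) := by
  intro v w hvw
  funext p
  rw [← liftLin_shift h v, hvw, liftLin_shift]

/-- A lifted direction is zero on the first row, so equalities with the top row impose nothing on it
and only those inherited from `I` remain. -/
theorem liftLin_mem_direction_iff (h : l.length = l'.length + 1)
    (I : Set (Idx l'.length × Bool)) (w : Idx l'.length → ℝ) :
    liftLin l'.length l.length w ∈ direction l.length (extendPattern h I) ↔
      w ∈ direction l'.length I := by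
  have key : ∀ (p : Idx l'.length) (β : Bool),
      entryLin l.length ((shift h p).1.1 - 1) ((shift h p).1.2 + β.toNat)
        (liftLin l'.length l.length w) = entryLin l'.length (p.1.1 - 1) (p.1.2 + β.toNat) w := by
    intro p β
    have hp := p.2
    have hβ := Bool.toNat_le β
    exact entryLin_liftLin w (by change 1 ≤ p.1.1 + 1 - 1 ∧ 1 ≤ p.1.2 + β.toNat ∧
      p.1.1 + 1 - 1 + (p.1.2 + β.toNat) ≤ l.length; omega)
  rw [mem_direction, mem_direction]
  constructor
  · rintro hw ⟨p, β⟩ hx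
    have := hw _ ((shift_mem_extendPattern h I p β).mpr hx)
    rwa [liftLin_shift, key] at this
  · rintro hw ⟨p, β⟩ hx
    rcases first_row_or_shift h p with hp | ⟨q, rfl⟩
    · rw [liftLin_of_first w hp, hp, Nat.sub_self, entryLin_zero]
      rfl
    · rw [liftLin_shift, key]
      exact hw _ ((shift_mem_extendPattern h I q β).mp hx)

/-! ### Applying a function to all entries -/

theorem getD_mem {l : List ℝ} {n : ℕ} (hn : n < l.length) : l.getD n 0 ∈ l := by
  rw [List.getD_eq_getElem _ _ hn]
  exact List.getElem_mem hn

theorem entry_comp {φ : ℝ → ℝ} (hφ : ∀ x ∈ l, φ x = x) (u : Idx l.length → ℝ) {a b : ℕ}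
    (hb : 1 ≤ b) (hab : a + b ≤ l.length) : entry l (φ ∘ u) a b = φ (entry l u a b) := by
  rcases Nat.eq_zero_or_pos a with rfl | ha
  · rw [entry_zero, entry_zero, hφ _ (getD_mem (by omega))]
  · rw [entry_of_mem ⟨ha, hb, hab⟩, entry_of_mem ⟨ha, hb, hab⟩]
    rfl

/-- The defining inequalities only compare entries, so a monotone function fixing the top row
preserves them. If it is also injective, no equality is gained or lost (`pattern_comp`). -/
theorem comp_mem_polytope {φ : ℝ → ℝ} (hmono : Monotone φ) (hφ : ∀ x ∈ l, φ x = x)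
    {u : Idx l.length → ℝ} (hu : u ∈ polytope l) : φ ∘ u ∈ polytope l := by
  intro p
  have hp := p.2
  rw [entry_comp hφ u (by omega) (by omega), entry_comp hφ u (by omega) (by omega)]
  exact ⟨hmono (hu p).1, hmono (hu p).2⟩

theorem pattern_comp {φ : ℝ → ℝ} (hinj : Function.Injective φ) (hφ : ∀ x ∈ l, φ x = x)
    (u : Idx l.length → ℝ) : pattern l (φ ∘ u) = pattern l u := by
  ext ⟨p, β⟩
  have hp := p.2
  have hβ := Bool.toNat_le β
  simp only [pattern, Set.mem_ofPred_eq]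
  rw [entry_comp hφ u (by omega) (by omega), Function.comp_apply, hinj.eq_iff]

/-- A function of the entries of a table that vanishes on the top row. -/
theorem comp_mem_direction {g : ℝ → ℝ} (hg : ∀ x ∈ l, g x = 0) (u : Idx l.length → ℝ) :
    g ∘ u ∈ direction l.length (pattern l u) := by
  rw [mem_direction]
  rintro ⟨p, β⟩ hx
  have hp := p.2
  have hβ := Bool.toNat_le β
  have hx' : u p = entry l u (p.1.1 - 1) (p.1.2 + β.toNat) := hx
  dsimp only
  rw [Function.comp_apply, hx']
  -- If the upper neighbour is in the top row, `g` vanishes there, in agreement with the zero top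
  -- row of a direction; otherwise it is an unknown and `g` respects the equality.
  by_cases ha : p.1.1 - 1 = 0
  · rw [ha, entry_zero, entryLin_zero, hg _ (getD_mem (by omega))]
    rfl
  · rw [entry_of_mem (by omega), entryLin_of_mem (by omega)]
    rfl

end Tables

/-! ### Moving interior points of unit intervals to midpoints -/

section Reparametrization

/-- The piecewise linear function that fixes `0` and `1` and maps `t` to `1 / 2`. -/
noncomputable def halve (t y : ℝ) : ℝ := if y ≤ t then y / (2 * t) else 1 - (1 - y) / (2 * (1 - t))

theorem halve_strictMono {t : ℝ} (ht : t ∈ Set.Ioo (0 : ℝ) 1) : StrictMono (halve t) := by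
  obtain ⟨h0, h1⟩ := ht
  -- The value `1 / 2` separates the two branches.
  have hle : ∀ y, y ≤ t → y / (2 * t) ≤ 1 / 2 := fun y hy => by
    rw [div_le_div_iff₀ (by linarith) (by norm_num)]
    linarith
  have hlt : ∀ y, t < y → (1 - y) / (2 * (1 - t)) < 1 / 2 := fun y hy => by
    rw [div_lt_div_iff₀ (by linarith) (by norm_num)]
    linarith
  intro x y hxy
  unfold halve
  split_ifs with hx hy hy
  · exact div_lt_div_of_pos_right hxy (by linarith)
  · linarith [hle x hx, hlt y (not_le.mp hy)]
  · linarith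
  · have := div_lt_div_of_pos_right (show 1 - y < 1 - x by linarith)
      (show 0 < 2 * (1 - t) by linarith)
    linarith

theorem halve_zero {t : ℝ} (ht : 0 < t) : halve t 0 = 0 := by
  rw [halve, if_pos ht.le, zero_div]

theorem halve_one {t : ℝ} (ht : t < 1) : halve t 1 = 1 := by
  rw [halve, if_neg (not_le.mpr ht), sub_self, zero_div, sub_zero]

theorem halve_self {t : ℝ} (ht : 0 < t) : halve t t = 1 / 2 := by
  rw [halve, if_pos le_rfl]
  field_simp

/-- A strictly increasing function that fixes the integers and maps a prescribed interior point of
every interval `[n, n + 1]` to the midpoint. -/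
theorem exists_strictMono_halving (t : ℤ → ℝ) (ht : ∀ n, t n ∈ Set.Ioo (0 : ℝ) 1) :
    ∃ φ : ℝ → ℝ, StrictMono φ ∧ (∀ n : ℤ, φ n = n) ∧ ∀ n : ℤ, φ (n + t n) = n + 1 / 2 := by
  -- `halve` acts on each unit interval separately; since it fixes `0` and `1`, the pieces fit
  -- together monotonically.
  refine ⟨fun x => ⌊x⌋ + halve (t ⌊x⌋) (Int.fract x), ?_, ?_, ?_⟩
  · intro x y hxy
    dsimp only
    rcases (Int.floor_le_floor hxy.le).eq_or_lt with h | h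
    · rw [h]
      have : Int.fract x < Int.fract y := by
        rw [Int.fract, Int.fract, h]
        linarith
      linarith [halve_strictMono (ht ⌊y⌋) this]
    · have h1 := halve_strictMono (ht ⌊x⌋) (Int.fract_lt_one x)
      rw [halve_one (ht _).2] at h1
      have h2 := (halve_strictMono (ht ⌊y⌋)).monotone (Int.fract_nonneg y)
      rw [halve_zero (ht _).1] at h2
      have h3 : (⌊x⌋ : ℝ) + 1 ≤ ⌊y⌋ := by exact_mod_cast h
      linarith
  · intro n
    simp [halve_zero (ht n).1]
  · intro n
    have h1 : ⌊(n : ℝ) + t n⌋ = n := by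
      rw [Int.floor_intCast_add, Int.floor_eq_zero_iff.mpr ⟨(ht n).1.le, (ht n).2⟩, add_zero]
    dsimp only
    rw [Int.fract, h1, add_sub_cancel_left, halve_self (ht n).1]

end Reparametrization

/-! ### Fibres over the cube and the decomposition of the set of faces -/

section Decomposition

variable {k : ℕ} {i : ℕ → ℕ}

/-- Extension of a point of `ℝ ^ (k - 1)` by zero to a sequence. -/
noncomputable def extendZero (c : Finset.Ico 1 k → ℝ) (q : ℕ) : ℝ :=
  if h : q ∈ Finset.Ico 1 k then c ⟨q, h⟩ else 0

theorem extendZero_apply (c : Finset.Ico 1 k → ℝ) (j : Finset.Ico 1 k) : extendZero c j = c j :=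
  dif_pos j.2

theorem extendZero_mem {c : Finset.Ico 1 k → ℝ} (hc : c ∈ cube k) :
    ∀ q ∈ Finset.Ico 1 k, (q : ℝ) ≤ extendZero c q ∧ extendZero c q ≤ (q : ℝ) + 1 := by
  intro q hq
  rw [extendZero_apply c ⟨q, hq⟩]
  exact hc ⟨q, hq⟩

/-- The position of the coordinate `u_{1, i_1 + … + i_j}`. -/
def cubePos (hi : ∀ q ∈ Finset.Icc 1 k, 1 ≤ i q) (j : Finset.Ico 1 k) : Idx (seq k i).length :=
  ⟨(1, partialSum i j), by
    have := partialSum_pos_lt hi j.2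
    rw [length_seq]
    exact ⟨le_rfl, this⟩⟩

theorem proj_apply (hi : ∀ q ∈ Finset.Icc 1 k, 1 ≤ i q) (u : Idx (seq k i).length → ℝ)
    (j : Finset.Ico 1 k) : proj k i u j = u (cubePos hi j) := by
  have h : 1 ≤ 1 ∧ 1 ≤ (∑ q ∈ Finset.Icc 1 (j : ℕ), i q) ∧
      1 + (∑ q ∈ Finset.Icc 1 (j : ℕ), i q) ≤ (seq k i).length := (cubePos hi j).2
  rw [proj, LinearMap.pi_apply, dif_pos h]
  rfl

theorem length_seq_eq (hk : 1 ≤ k) (hi : ∀ q ∈ Finset.Icc 1 k, 1 ≤ i q) (c : ℕ → ℝ) :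
    (seq k i).length = (belowRow k i c).length + 1 := by
  rw [length_seq, length_belowRow hk c hi]

theorem proj_mem_cube (hi : ∀ q ∈ Finset.Icc 1 k, 1 ≤ i q) {u : Idx (seq k i).length → ℝ}
    (hu : u ∈ polytope (seq k i)) : proj k i u ∈ cube k := by
  intro j
  have h := getD_partialSum hi 0 j.2
  have h1 := hu (cubePos hi j)
  rw [proj_apply hi]
  change entry _ u 0 (partialSum i j) ≤ _ ∧ _ ≤ entry _ u 0 (partialSum i j + 1) at h1
  rwa [entry_zero, entry_zero, Nat.add_sub_cancel, h.1, h.2.1] at h1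

/-- The first row of unknowns is determined by the projection to the cube. -/
theorem first_row_eq (hi : ∀ q ∈ Finset.Icc 1 k, 1 ≤ i q) {u : Idx (seq k i).length → ℝ}
    (hu : u ∈ polytope (seq k i)) (p : Idx (seq k i).length) (hp : p.1.1 = 1) :
    u p = (belowRow k i (extendZero (proj k i u))).getD (p.1.2 - 1) 0 := by
  have hp2 := p.2
  have hl := length_seq k i
  have h1 := hu p
  rw [hp, Nat.sub_self, entry_zero, entry_zero, Nat.add_sub_cancel] at h1
  have hb : p.1.2 - 1 + 1 = p.1.2 := by omega
  -- Inside a block the two upper neighbours coincide and pinch the entry; between blocks the entry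
  -- is a coordinate of the projection.
  rcases position_cases hi (extendZero (proj k i u)) (n := p.1.2 - 1) (by omega) with
    ⟨q, -, e1, e2, e3⟩ | ⟨q, hq, e0, e1, e2, e3⟩
  · rw [hb] at e2
    rw [e1, e2] at h1
    rw [e3]
    exact le_antisymm h1.2 h1.1
  · rw [e3, extendZero_apply _ ⟨q, hq⟩, proj_apply hi]
    congr 1
    exact Subtype.ext (Prod.ext hp (by rw [← hb, e0]; rfl))

theorem proj_eq_of_first_row (hi : ∀ q ∈ Finset.Icc 1 k, 1 ≤ i q) {c : Finset.Ico 1 k → ℝ}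
    {u : Idx (seq k i).length → ℝ} (hu : ∀ p : Idx (seq k i).length, p.1.1 = 1 →
      u p = (belowRow k i (extendZero c)).getD (p.1.2 - 1) 0) : proj k i u = c := by
  funext j
  rw [proj_apply hi, hu _ rfl]
  exact (getD_partialSum hi _ j.2).2.2.trans (extendZero_apply c j)

/-- The fibre over a point of the cube is a copy of a smaller Gelfand–Tsetlin polytope. -/
theorem fibre_eq (hk : 1 ≤ k) (hi : ∀ q ∈ Finset.Icc 1 k, 1 ≤ i q) {c : Finset.Ico 1 k → ℝ}
    (hc : c ∈ cube k) : polytope (seq k i) ∩ proj k i ⁻¹' {c} =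
      lift (belowRow k i (extendZero c)) (seq k i).length ''
        polytope (belowRow k i (extendZero c)) := by
  have hl := length_seq_eq hk hi (extendZero c)
  have hl' := length_seq k i
  rw [image_lift_polytope hl fun n hn => belowRow_interlacing hi (extendZero_mem hc) (by omega)]
  ext u
  constructor
  · rintro ⟨hu, rfl⟩
    exact ⟨hu, first_row_eq hi hu⟩
  · rintro ⟨hu, h1⟩
    exact ⟨hu, proj_eq_of_first_row hi h1⟩

/-- Surjectivity holds because each fibre is a copy of the polytope of a nondecreasing row, which is
nonempty. -/
theorem image_proj (hk : 1 ≤ k) (hi : ∀ q ∈ Finset.Icc 1 k, 1 ≤ i q) :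
    proj k i '' polytope (seq k i) = cube k := by
  ext c
  constructor
  · rintro ⟨u, hu, rfl⟩
    exact proj_mem_cube hi hu
  · intro hc
    obtain ⟨w, hw⟩ := nonempty_polytope (l := belowRow k i (extendZero c))
      fun n hn => belowRow_step hk hi (extendZero_mem hc) hn
    have h := Set.mem_image_of_mem (lift _ (seq k i).length) hw
    rw [← fibre_eq hk hi hc] at h
    exact ⟨_, h.1, h.2⟩

/-- The first row of unknowns over the barycenter of a face of the cube. -/
noncomputable abbrev baryRow (i : ℕ → ℕ) (e : Finset.Ico 1 k → Fin 3) : List ℝ :=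
  belowRow k i (extendZero (barycenter e))

theorem reducedSeq_eq_baryRow (hk : 1 ≤ k) (hi : ∀ q ∈ Finset.Icc 1 k, 1 ≤ i q)
    (e : Finset.Ico 1 k → Fin 3) : reducedSeq k i (exponent e) = baryRow i e :=
  reducedSeq_exponent hk hi e fun j => extendZero_apply _ j

theorem combEquiv_fibre (hk : 1 ≤ k) (hi : ∀ q ∈ Finset.Icc 1 k, 1 ≤ i q)
    (e : Finset.Ico 1 k → Fin 3) :
    CombEquiv (polytope (seq k i) ∩ proj k i ⁻¹' {barycenter e})
      (polytope (reducedSeq k i (exponent e))) := by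
  rw [reducedSeq_eq_baryRow hk hi, fibre_eq hk hi (barycenter_mem_cubeFace e).1]
  exact combEquiv_image_lift (length_seq_eq hk hi _)

theorem exists_nat_of_mem_seq {x : ℝ} (hx : x ∈ seq k i) : ∃ q : ℕ, x = q := by
  obtain ⟨q, -, hq⟩ := List.mem_flatMap.mp hx
  exact ⟨q, List.eq_of_mem_replicate hq⟩

/-- Every point of the polytope has the same pattern as some point over the barycenter of a face
of the cube. -/
theorem exists_pattern_eq (hi : ∀ q ∈ Finset.Icc 1 k, 1 ≤ i q) {u : Idx (seq k i).length → ℝ}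
    (hu : u ∈ polytope (seq k i)) : ∃ (e : Finset.Ico 1 k → Fin 3),
      ∃ v ∈ polytope (seq k i) ∩ proj k i ⁻¹' {barycenter e},
        pattern (seq k i) v = pattern (seq k i) u := by
  classical
  set c := proj k i u with hcdef
  have hc : c ∈ cube k := proj_mem_cube hi hu
  -- `t n` is the offset of the coordinate c_n inside [n, n+1]. Where that coordinate is an endpoint
  -- or does not exist there is nothing to move, and `1 / 2` serves as an arbitrary interior value.
  let t : ℤ → ℝ := fun n => if extendZero c n.toNat - n ∈ Set.Ioo (0 : ℝ) 1 then
    extendZero c n.toNat - n else 1 / 2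
  have ht : ∀ n, t n ∈ Set.Ioo (0 : ℝ) 1 := by
    intro n
    dsimp only [t]
    split_ifs with h
    · exact h
    · norm_num
  obtain ⟨φ, hmono, hint, hhalf⟩ := exists_strictMono_halving t ht
  have hnat : ∀ n : ℕ, φ n = n := fun n => by exact_mod_cast hint n
  have hφ : ∀ x ∈ seq k i, φ x = x := by
    intro x hx
    obtain ⟨q, rfl⟩ := exists_nat_of_mem_seq hx
    exact hnat q
  -- This is the face of the cube containing `c` in its relative interior; `φ` sends `c` to its
  -- barycenter.
  refine ⟨fun j => if c j = j then 0 else if c j = (j : ℝ) + 1 then 2 else 1, φ ∘ u,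
    ⟨comp_mem_polytope hmono.monotone hφ hu, ?_⟩, pattern_comp hmono.injective hφ u⟩
  funext j
  rw [proj_apply hi, Function.comp_apply, ← proj_apply hi u, ← hcdef, barycenter]
  split_ifs with h1 h2
  · rw [h1, hnat]
    simp
  · have := hnat (j + 1)
    push_cast at this
    rw [h2, this]
    norm_num
  · obtain ⟨h3, h4⟩ := hc j
    have h5 : c j - j ∈ Set.Ioo (0 : ℝ) 1 :=
      ⟨sub_pos.mpr (lt_of_le_of_ne h3 (Ne.symm h1)), by
        have := lt_of_le_of_ne h4 h2
        linarith⟩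
    have h6 : t (j : ℕ) = c j - j := by
      have : extendZero c ((j : ℕ) : ℤ).toNat - (((j : ℕ) : ℤ) : ℝ) = c j - j := by
        rw [Int.toNat_natCast, extendZero_apply, Int.cast_natCast]
      dsimp only [t]
      rw [this, if_pos h5]
    have h7 := hhalf (j : ℕ)
    rw [h6, Int.cast_natCast, add_sub_cancel] at h7
    rw [h7]
    simp

/-- The patterns of the polytope, sorted by the faces of the cube. -/
theorem image_pattern_eq (hk : 1 ≤ k) (hi : ∀ q ∈ Finset.Icc 1 k, 1 ≤ i q) :
    pattern (seq k i) '' polytope (seq k i) = ⋃ e : Finset.Ico 1 k → Fin 3,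
      extendPattern (length_seq_eq hk hi (extendZero (barycenter e))) ''
        (pattern (baryRow i e) '' polytope (baryRow i e)) := by
  ext I
  rw [Set.mem_iUnion]
  constructor
  · rintro ⟨u, hu, rfl⟩
    obtain ⟨e, v, hv, hvu⟩ := exists_pattern_eq hi hu
    rw [fibre_eq hk hi (barycenter_mem_cubeFace e).1] at hv
    obtain ⟨w, hw, rfl⟩ := hv
    exact ⟨e, _, ⟨w, hw, rfl⟩, by rw [← hvu, pattern_lift]⟩
  · rintro ⟨e, _, ⟨w, hw, rfl⟩, rfl⟩
    have h := Set.mem_image_of_mem (lift _ (seq k i).length) hw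
    rw [← fibre_eq hk hi (barycenter_mem_cubeFace e).1] at h
    exact ⟨_, h.1, pattern_lift _ w⟩

/-- The entry j + e_j/2 sits below the neighbours j and j+1, so its equalities with them reveal `e
j`, whatever `I` is. With `cubePos_true_mem` this recovers the face of the cube from a pattern. -/
theorem cubePos_false_mem (hk : 1 ≤ k) (hi : ∀ q ∈ Finset.Icc 1 k, 1 ≤ i q)
    (e : Finset.Ico 1 k → Fin 3) (I : Set (Idx (baryRow i e).length × Bool))
    (j : Finset.Ico 1 k) :
    (cubePos hi j, false) ∈ extendPattern (length_seq_eq hk hi (extendZero (barycenter e))) I ↔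
      e j = 0 := by
  have h := getD_partialSum hi (extendZero (barycenter e)) j.2
  rw [first_mem_extendPattern _ _ rfl]
  change (baryRow i e).getD (partialSum i j - 1) 0 =
    (seq k i).getD (partialSum i j + 0 - 1) 0 ↔ _
  rw [add_zero, h.1, h.2.2, extendZero_apply, barycenter, add_eq_left, div_eq_zero_iff,
    or_iff_left two_ne_zero, Nat.cast_eq_zero, Fin.ext_iff]
  rfl

theorem cubePos_true_mem (hk : 1 ≤ k) (hi : ∀ q ∈ Finset.Icc 1 k, 1 ≤ i q)
    (e : Finset.Ico 1 k → Fin 3) (I : Set (Idx (baryRow i e).length × Bool))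
    (j : Finset.Ico 1 k) :
    (cubePos hi j, true) ∈ extendPattern (length_seq_eq hk hi (extendZero (barycenter e))) I ↔
      e j = 2 := by
  have h := getD_partialSum hi (extendZero (barycenter e)) j.2
  rw [first_mem_extendPattern _ _ rfl]
  change (baryRow i e).getD (partialSum i j - 1) 0 =
    (seq k i).getD (partialSum i j + 1 - 1) 0 ↔ _
  rw [Nat.add_sub_cancel, h.2.1, h.2.2, extendZero_apply, barycenter, add_right_inj,
    div_eq_one_iff_eq two_ne_zero, Fin.ext_iff]
  norm_cast

theorem extendPattern_face_unique (hk : 1 ≤ k) (hi : ∀ q ∈ Finset.Icc 1 k, 1 ≤ i q)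
    {e e' : Finset.Ico 1 k → Fin 3} {I : Set (Idx (baryRow i e).length × Bool)}
    {I' : Set (Idx (baryRow i e').length × Bool)}
    (h : extendPattern (length_seq_eq hk hi (extendZero (barycenter e))) I =
      extendPattern (length_seq_eq hk hi (extendZero (barycenter e'))) I') : e = e' := by
  funext j
  have h0 := cubePos_false_mem hk hi e I j
  have h2 := cubePos_true_mem hk hi e I j
  rw [h, cubePos_false_mem hk] at h0
  rw [h, cubePos_true_mem hk] at h2
  simp only [Fin.ext_iff] at h0 h2 ⊢
  have := (e j).isLt
  have := (e' j).isLt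
  change _ = 0 ↔ _ = 0 at h0
  change _ = 2 ↔ _ = 2 at h2
  omega

/-- The dimension of a face of the polytope is the sum of the dimension of the face of the cube
and the dimension of the face of the fibre. -/
theorem finrank_direction_extendPattern (hk : 1 ≤ k) (hi : ∀ q ∈ Finset.Icc 1 k, 1 ≤ i q)
    (e : Finset.Ico 1 k → Fin 3) (w : Idx (baryRow i e).length → ℝ) :
    Module.finrank ℝ (direction (seq k i).length
      (extendPattern (length_seq_eq hk hi (extendZero (barycenter e))) (pattern _ w))) =
      Fintype.card {j // e j = 1} +
        Module.finrank ℝ (direction (baryRow i e).length (pattern _ w)) := by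
  classical
  have hl := length_seq_eq hk hi (extendZero (barycenter e))
  set V := direction (seq k i).length (extendPattern hl (pattern _ w))
  -- Rank–nullity is applied to the restriction of directions to the free coordinates of the cube
  -- face.
  let ρ : (Idx (seq k i).length → ℝ) →ₗ[ℝ] ({j // e j = 1} → ℝ) :=
    LinearMap.funLeft ℝ ℝ fun j => cubePos hi j.1
  have hsurj : LinearMap.range (ρ.domRestrict V) = ⊤ := by
    rw [LinearMap.range_eq_top]
    intro d
    -- The free coordinates have distinct half-integral values, while the top row is integral. Hence
    -- `g` applied to the entries of the table is a direction with the prescribed values `d`.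
    let g : ℝ → ℝ := fun x => ∑ j : {j // e j = 1}, if x = (j.1 : ℝ) + 1 / 2 then d j else 0
    have hg : ∀ x ∈ seq k i, g x = 0 := by
      intro x hx
      obtain ⟨q, rfl⟩ := exists_nat_of_mem_seq hx
      refine Finset.sum_eq_zero fun j _ => if_neg fun h => ?_
      have h' : (2 * q : ℝ) = 2 * (j.1 : ℕ) + 1 := by linarith
      norm_cast at h'
      omega
    have hmem := comp_mem_direction hg (lift (baryRow i e) (seq k i).length w)
    rw [pattern_lift hl] at hmem
    refine ⟨⟨_, hmem⟩, ?_⟩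
    funext j
    change g (lift (baryRow i e) (seq k i).length w (cubePos hi j.1)) = d j
    have hval : lift (baryRow i e) (seq k i).length w (cubePos hi j.1) = (j.1 : ℝ) + 1 / 2 := by
      rw [lift_of_first w rfl]
      refine (getD_partialSum hi _ j.1.2).2.2.trans ?_
      rw [extendZero_apply, barycenter, j.2]
      norm_num
    rw [hval]
    dsimp only [g]
    rw [Finset.sum_eq_single j, if_pos rfl]
    · intro j' _ hne
      refine if_neg fun h => hne ?_
      have h' : (j.1 : ℕ) = (j'.1 : ℕ) := by exact_mod_cast (add_right_cancel h)
      exact (Subtype.ext (Subtype.ext h')).symm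
    · exact fun h => absurd (Finset.mem_univ j) h
  -- All other first-row entries equal an upper neighbour, so a direction in the kernel vanishes on
  -- the entire first row and comes from the lower table.
  have hker : (LinearMap.ker (ρ.domRestrict V)).map V.subtype =
      (direction (baryRow i e).length (pattern _ w)).map
        (liftLin (baryRow i e).length (seq k i).length).toLinearMap := by
    ext v
    constructor
    · rintro ⟨⟨v, hv⟩, hρ, rfl⟩
      have hρ' : ∀ j : {j // e j = 1}, v (cubePos hi j.1) = 0 := congrFun hρ
      have hrow : ∀ p : Idx (seq k i).length, p.1.1 = 1 → v p = 0 := by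
        intro p hp
        have hp2 := p.2
        have hls := length_seq k i
        have hact : ∀ β : Bool, (p, β) ∈ extendPattern hl (pattern _ w) → v p = 0 := by
          intro β hβ
          have h := mem_direction.mp hv _ hβ
          dsimp only at h
          rw [hp, Nat.sub_self, entryLin_zero] at h
          exact h
        rcases position_cases hi (extendZero (barycenter e)) (n := p.1.2 - 1) (by omega) with
          ⟨q, -, e1, e2, e3⟩ | ⟨q, hq, e0, -⟩
        · exact hact false ((first_mem_extendPattern hl _ hp false).mpr (e3.trans e1.symm))
        · have hpq : p = cubePos hi ⟨q, hq⟩ :=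
            Subtype.ext (Prod.ext hp (by change p.1.2 = partialSum i q; omega))
          by_cases h0 : e ⟨q, hq⟩ = 0
          · exact hact false (by rw [hpq]; exact (cubePos_false_mem hk hi e _ _).mpr h0)
          by_cases h2 : e ⟨q, hq⟩ = 2
          · exact hact true (by rw [hpq]; exact (cubePos_true_mem hk hi e _ _).mpr h2)
          · rw [hpq]
            refine hρ' ⟨⟨q, hq⟩, ?_⟩
            revert h0 h2
            generalize e ⟨q, hq⟩ = x
            revert x
            decide
      have hlift := liftLin_dropRow hl hrow
      exact ⟨_, (liftLin_mem_direction_iff hl _ _).mp (by rwa [hlift]), hlift⟩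
    · rintro ⟨v, hv, rfl⟩
      refine ⟨⟨_, (liftLin_mem_direction_iff hl _ v).mpr hv⟩, ?_, rfl⟩
      funext j
      exact liftLin_of_first v (p := cubePos hi j.1) rfl
  have hrank := LinearMap.finrank_range_add_finrank_ker (ρ.domRestrict V)
  rw [hsurj, finrank_top, Module.finrank_fintype_fun_eq_card,
    ← Submodule.finrank_map_subtype_eq, hker,
    ← (Submodule.equivMapOfInjective _ (liftLin_injective hl) _).finrank_eq] at hrank
  exact hrank.symm

theorem fPoly_polytope (l : List ℝ) {T : Finset (Set (Idx l.length × Bool))}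
    (hT : ∀ I, I ∈ T ↔ I ∈ pattern l '' polytope l) :
    fPoly (polytope l) = ∑ I ∈ T, Polynomial.X ^ Module.finrank ℝ (direction l.length I) := by
  rw [← activeSet_ineq, polytope_eq_polyhedron] at hT
  rw [polytope_eq_polyhedron, fPoly_polyhedron hT]

/-- The patterns form a disjoint union of injective images of the patterns of the fibres, and the
dimension formula turns each class into a power of `X` times the f-polynomial of a fibre. -/
theorem fPoly_seq (hk : 1 ≤ k) (hi : ∀ q ∈ Finset.Icc 1 k, 1 ≤ i q) :
    fPoly (polytope (seq k i)) = ∑ e : Finset.Ico 1 k → Fin 3,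
      Polynomial.X ^ Fintype.card {j // e j = 1} *
        fPoly (polytope (reducedSeq k i (exponent e))) := by
  classical
  let T : ∀ e : Finset.Ico 1 k → Fin 3, Finset (Set (Idx (baryRow i e).length × Bool)) :=
    fun e => (Set.toFinite (pattern (baryRow i e) '' polytope (baryRow i e))).toFinset
  have hT : ∀ e I, I ∈ T e ↔ I ∈ pattern (baryRow i e) '' polytope (baryRow i e) :=
    fun e I => Set.Finite.mem_toFinset _
  rw [fPoly_polytope _ (T := Finset.univ.biUnion fun e => (T e).image
    (extendPattern (length_seq_eq hk hi (extendZero (barycenter e))))), Finset.sum_biUnion]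
  · refine Finset.sum_congr rfl fun e _ => ?_
    rw [reducedSeq_eq_baryRow hk hi, fPoly_polytope _ (hT e), Finset.mul_sum,
      Finset.sum_image (extendPattern_injective _).injOn]
    refine Finset.sum_congr rfl fun I hI => ?_
    obtain ⟨w, -, rfl⟩ := (hT e I).mp hI
    rw [finrank_direction_extendPattern hk hi, pow_add]
  · intro e _ e' _ hne
    rw [Function.onFun, Finset.disjoint_left]
    intro I hI hI'
    obtain ⟨J, -, rfl⟩ := Finset.mem_image.mp hI
    obtain ⟨J', -, h⟩ := Finset.mem_image.mp hI'
    exact hne (extendPattern_face_unique hk hi h.symm)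
  · intro I
    rw [image_pattern_eq hk hi]
    simp [hT]

end Decomposition

/-! ### Dimensions of the cube's faces and coefficients of the polynomial p -/

section CubeFaces

variable {k : ℕ}

theorem dim_cubeFace (e : Finset.Ico 1 k → Fin 3) :
    dim (cubeFace e) = Fintype.card {j // e j = 1} := by
  classical
  let f : ({j // e j = 1} → ℝ) →ₗ[ℝ] (Finset.Ico 1 k → ℝ) :=
    Function.ExtendByZero.linearMap ℝ Subtype.val
  have hf : Function.Injective f := fun v w h => by
    funext j
    have := congrFun h j.1
    simpa [f, Subtype.val_injective.extend_apply] using this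
  have hspan : vectorSpan ℝ (cubeFace e) = LinearMap.range f := by
    apply le_antisymm
    · rw [vectorSpan_def, Submodule.span_le]
      rintro _ ⟨u, hu, v, hv, rfl⟩
      refine ⟨fun j => u j.1 - v j.1, ?_⟩
      funext j
      change Function.extend Subtype.val (fun j : {j // e j = 1} => u j.1 - v j.1) 0 j = u j - v j
      by_cases hj : e j = 1
      · exact Subtype.val_injective.extend_apply _ _ (⟨j, hj⟩ : {j // e j = 1})
      · rw [Function.extend_apply' _ _ _ (by rintro ⟨x, rfl⟩; exact hj x.2), Pi.zero_apply]
        have h02 : e j = 0 ∨ e j = 2 := by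
          revert hj
          generalize e j = x
          revert x
          decide
        rcases h02 with h | h
        · rw [(hu.2 j).1 h, (hv.2 j).1 h, sub_self]
        · rw [(hu.2 j).2 h, (hv.2 j).2 h, sub_self]
    · rintro _ ⟨v, rfl⟩
      rw [pi_eq_sum_univ v, map_sum]
      refine Submodule.sum_mem _ fun j _ => ?_
      rw [map_smul]
      refine Submodule.smul_mem _ _ ?_
      -- Moving a free coordinate of the barycenter to its upper end changes it by `1 / 2`, so twice
      -- the difference is the basis vector.
      have hu : Function.update (barycenter e) j.1 ((j.1 : ℝ) + 1) ∈ cubeFace e := by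
        refine ⟨fun x => ?_, fun x => ?_⟩
        · by_cases hx : x = j.1
          · subst hx
            simp
          · rw [Function.update_of_ne hx]
            exact (barycenter_mem_cubeFace e).1 x
        · by_cases hx : x = j.1
          · rw [hx, j.2]
            exact ⟨fun h => by simp at h, fun h => by simp [Fin.ext_iff] at h⟩
          · rw [Function.update_of_ne hx]
            exact (barycenter_mem_cubeFace e).2 x
      have hmem := Submodule.smul_mem _ (2 : ℝ)
        (vsub_mem_vectorSpan ℝ hu (barycenter_mem_cubeFace e))
      convert hmem using 1
      funext x
      change Function.extend Subtype.val (fun y : {y // e y = 1} => if j = y then (1 : ℝ) else 0)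
        0 x = 2 * (Function.update (barycenter e) j.1 ((j.1 : ℝ) + 1) x - barycenter e x)
      by_cases hx : x = j.1
      · rw [hx, Subtype.val_injective.extend_apply, if_pos rfl, Function.update_self, barycenter,
          j.2]
        norm_num
      · rw [Function.update_of_ne hx, sub_self, mul_zero]
        by_cases hx1 : e x = 1
        · refine (Subtype.val_injective.extend_apply _ _ (⟨x, hx1⟩ : {y // e y = 1})).trans ?_
          exact if_neg fun h => hx (congrArg Subtype.val h).symm
        · exact Function.extend_apply' _ _ _ (by rintro ⟨y, rfl⟩; exact hx1 y.2)
  rw [dim, hspan, LinearMap.finrank_range_of_inj hf, Module.finrank_fintype_fun_eq_card]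

/-- Expanding the product means choosing one summand in each factor, and such a choice is an `e`. -/
theorem monomialPoly_eq_sum (k : ℕ) : monomialPoly k =
    ∑ e : Finset.Ico 1 k → Fin 3, MvPolynomial.monomial (exponent e) 1 := by
  have h : monomialPoly k = ∏ j : Finset.Ico 1 k, ∑ x : Fin 3,
      (MvPolynomial.X (2 * (j : ℕ) + (x : ℕ)) : MvPolynomial ℕ ℕ) := by
    rw [monomialPoly, ← Finset.prod_coe_sort]
    refine Finset.prod_congr rfl fun j _ => ?_
    rw [Fin.sum_univ_three]
    rfl
  rw [h, Finset.prod_univ_sum, Fintype.piFinset_univ]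
  refine Finset.sum_congr rfl fun e _ => ?_
  rw [exponent, MvPolynomial.monomial_sum_one]
  rfl

/-- By `exponent_injective` no two choices in the expansion give the same monomial. -/
theorem coeff_monomialPoly (e : Finset.Ico 1 k → Fin 3) :
    (monomialPoly k).coeff (exponent e) = 1 := by
  classical
  rw [monomialPoly_eq_sum, MvPolynomial.coeff_sum, Finset.sum_eq_single e]
  · rw [MvPolynomial.coeff_monomial, if_pos rfl]
  · intro e' _ hne
    rw [MvPolynomial.coeff_monomial, if_neg fun h => hne (exponent_injective k h)]
  · exact fun h => absurd (Finset.mem_univ e) h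

theorem support_monomialPoly (k : ℕ) : (monomialPoly k).support =
    Finset.univ.map ⟨(exponent : (Finset.Ico 1 k → Fin 3) → _), exponent_injective k⟩ := by
  classical
  ext α
  rw [Finset.mem_map]
  constructor
  · intro hα
    rw [monomialPoly_eq_sum] at hα
    obtain ⟨e, he, hα'⟩ := Finset.mem_biUnion.mp (MvPolynomial.support_sum hα)
    exact ⟨e, he, (Finset.mem_singleton.mp (MvPolynomial.support_monomial_subset hα')).symm⟩
  · rintro ⟨e, -, rfl⟩
    rw [MvPolynomial.mem_support_iff]
    change (monomialPoly k).coeff (exponent e) ≠ 0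
    rw [coeff_monomialPoly]
    exact one_ne_zero

end CubeFaces

end GZ

/-! ### The main theorem -/

theorem mainTheorem1 (k : ℕ) (hk : 1 ≤ k) (i : ℕ → ℕ) (hi : ∀ q ∈ Finset.Icc 1 k, 1 ≤ i q) :
    GZ.proj k i '' GZ.polytope (GZ.seq k i) = GZ.cube k ∧
    (∀ e : Finset.Ico 1 k → Fin 3,
      GZ.CombEquiv
        (GZ.polytope (GZ.seq k i) ∩ GZ.proj k i ⁻¹' {GZ.barycenter e})
        (GZ.polytope (GZ.reducedSeq k i (GZ.exponent e)))) ∧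
    GZ.fPoly (GZ.polytope (GZ.seq k i)) =
      ∑ α ∈ (GZ.monomialPoly k).support,
        Polynomial.C ((GZ.monomialPoly k).coeff α) *
          Polynomial.X ^ GZ.dim (GZ.faceOfExponent k α) *
          GZ.fPoly (GZ.polytope (GZ.reducedSeq k i α)) := by
  refine ⟨GZ.image_proj hk hi, GZ.combEquiv_fibre hk hi, ?_⟩
  rw [GZ.fPoly_seq hk hi, GZ.support_monomialPoly, Finset.sum_map]
  refine Finset.sum_congr rfl fun e _ => ?_
  change _ = Polynomial.C ((GZ.monomialPoly k).coeff (GZ.exponent e)) *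
    Polynomial.X ^ GZ.dim (GZ.faceOfExponent k (GZ.exponent e)) *
    GZ.fPoly (GZ.polytope (GZ.reducedSeq k i (GZ.exponent e)))
  rw [GZ.coeff_monomialPoly, GZ.faceOfExponent_exponent, GZ.dim_cubeFace, map_one, one_mul]
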